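/- For every $n$ let $Z$ be a random $n\times p$ matrix ($p=p_n>n$), let $\mu,\nu,\eta,\epsilon$ be random vectors in $\mathbb R^n$, all depending on $n$, and let $\beta\in\mathbb R$ be fixed. Consider $$Y=X\beta+\mu+\epsilon,\qquad X=\nu+\eta .$$ For $m\subseteq\{1,\dots,p\}$ let $Z_m$ be the submatrix of columns of $Z$ indexed by $m$, let $P_m^\perp$ be the orthogonal projection onto the orthogonal complement of the column space of $Z_m$, and let $\mathcal M_u=\{m\subseteq\{1,\dots,p\}:|m|=u\}$. A sequence of random vectors $v=v_n\in\mathbb R^n$ is called weakly sparse relative to $Z$ with sparsity $s=s_n$ at rate $k=k_n$ if there are non-random $m_n\in\mathcal M_{s_n}$ with $\|P_{m_n}^\perp v_n\|^2=o_p(k_n)$ (for non-random $v$ and $Z$ this means $o(k_n)$). Let $K_\epsilon,K_\eta,\sigma_\epsilon\ge 0$ and $\sigma_\eta>0$ be constants, and assume: 1. $\|\mu\|^2=O_p(n)$ and $\|\nu\|^2=O_p(n)$. 2. For every $n$, the $2n$ entries of $\eta$ and $\epsilon$ are mutually independent, and $(\eta,\epsilon)$ is independent of $(Z,\mu,\nu)$.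 The entries of $\eta$ are identically distributed with mean $0$, variance $\sigma_\eta^2$ and $\mathbb E e^{\lambda\eta_1}\le e^{K_\eta^2\lambda^2/2}$ for all $\lambda\in\mathbb R$; those of $\epsilon$ are identically distributed with mean $0$, variance $\sigma_\epsilon^2$ and $\mathbb E e^{\lambda\epsilon_1}\le e^{K_\epsilon^2\lambda^2/2}$ for all $\lambda\in\mathbb R$. 3. $\mu$, $\nu$ and $\nu\beta+\mu$ are weakly sparse relative to $Z$ at rate $\sqrt n$ with sparsities $s_\gamma,s_\delta,s_\theta$. The chosen model sizes satisfy $u_\gamma\ge s_\gamma$, $u_\delta\ge s_\delta$, $u_\theta\ge s_\theta$ for all large $n$, and $\max(u_\gamma,u_\delta,u_\theta)=o(\sqrt n/\log p)$. Fix constants $\alpha_Y>4K_\epsilon^2$ and $\alpha_X>4K_\eta^2$. For $m\in\mathcal M_{u_\theta}$ let $\hat\theta_m\in\mathbb R^p$ be supported on $m$ with entries $(Z_m^TZ_m)^{-1}Z_m^TY$ there (Moore–Penrose inverse), and put $$w_{m,Y}=\frac{\exp(-\|P_m^\perp Y\|^2/\alpha_Y)}{\sum_{k\in\mathcal M_{u_\theta}}\exp(-\|P_k^\perp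 Y\|^2/\alpha_Y)},\qquad \hat\theta_{EW}=\sum_{m\in\mathcal M_{u_\theta}}w_{m,Y}\hat\theta_m .$$ Define $\hat\delta_{EW}$ in the same way from $X$, $\alpha_X$, $u_\delta$, and let $$\hat\beta_{EW}=\frac{(X-Z\hat\delta_{EW})^T(Y-Z\hat\theta_{EW})}{\|X-Z\hat\delta_{EW}\|^2}.$$ Then, without any compatibility condition on the design, $$\sqrt n\,(\hat\beta_{EW}-\beta)\ \to\ N\!\left(0,\frac{\sigma_\epsilon^2}{\sigma_\eta^2}\right)\quad\text{in distribution as } n\to\infty .$$ Moreover, if $\epsilon$ is Gaussian with $\sigma_\epsilon>0$, this limiting variance is the semiparametric information bound for $\beta$: for every $n\ge 1$, $$\sup_{h}\ \frac{n}{I_n(h)}=\frac{\sigma_\epsilon^2}{\sigma_\eta^2},$$ where $h$ ranges over all $\mathbb R^n$-valued measurable functions of $(Z,\mu,\nu)$ and $I_n(h)\in[0,\infty]$ is the Fisher information at $t=0$ (the expected squared score) of the one-dimensional submodel in which, given $(X,Z,\mu,\nu)$, $Y\sim N\big(X(\beta+t)+\mu+th,\ \sigma_\epsilon^2 I_n\big)$.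 -/

import Mathlib

open MeasureTheory ProbabilityTheory Filter Topology Asymptotics
open scoped NNReal ENNReal Matrix

noncomputable section

namespace ExpWeights

/-! ### Stochastic order symbols along a sequence of probability spaces -/

/-- `V n = O_p(r n)`: the sequence `V n / r n` is bounded in probability. -/
def IsBigOInProb {Ω : ℕ → Type*} [∀ n, MeasurableSpace (Ω n)] (P : ∀ n, Measure (Ω n))
    (V : ∀ n, Ω n → ℝ) (r : ℕ → ℝ) : Prop :=
  ∀ κ : ℝ≥0∞, 0 < κ → ∃ C : ℝ, ∀ᶠ n in atTop, P n {ω | C * r n < |V n ω|} ≤ κ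

/-- `V n = o_p(r n)`: the sequence `V n / r n` converges to zero in probability. -/
def IsLittleOInProb {Ω : ℕ → Type*} [∀ n, MeasurableSpace (Ω n)] (P : ∀ n, Measure (Ω n))
    (V : ∀ n, Ω n → ℝ) (r : ℕ → ℝ) : Prop :=
  ∀ κ : ℝ, 0 < κ → Tendsto (fun n => P n {ω | κ * r n < |V n ω|}) atTop (𝓝 0)

/-! ### Models, projections and weak sparsity -/

section Models

variable {n p : ℕ}

/-- The collection `𝓜_u` of all models of size `u`. -/
def models (p u : ℕ) : Finset (Finset (Fin p)) :=
  Finset.powersetCard u Finset.univ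

/-- The sub-matrix `Z_m` of the columns of `Z` indexed by `m`. -/
def subMatrix (Z : Matrix (Fin n) (Fin p) ℝ) (m : Finset (Fin p)) : Matrix (Fin n) m ℝ :=
  Z.submatrix id (fun j => (j : Fin p))

/-- The column space of `Z_m`. -/
def colSpace (Z : Matrix (Fin n) (Fin p) ℝ) (m : Finset (Fin p)) :
    Submodule ℝ (EuclideanSpace ℝ (Fin n)) :=
  Submodule.span ℝ ((fun j => WithLp.toLp 2 (Z.col j)) '' (m : Set (Fin p)))

/-- `‖P_m^⊥ v‖²`, where `P_m^⊥` is the orthogonal projection onto the orthogonal complement of the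
column space of `Z_m`. -/
def residualSq (Z : Matrix (Fin n) (Fin p) ℝ) (m : Finset (Fin p))
    (v : EuclideanSpace ℝ (Fin n)) : ℝ :=
  ‖(colSpace Z m)ᗮ.starProjection v‖ ^ 2

end Models

/-- The random vectors `v n` have the weak sparsity property relative to `Z` in probability, with
sparsity `s` at rate `k`: for some (non-random) sequence of models `m n` of size `s n`,
`‖P_{m n}^⊥ (v n)‖² = o_p(k n)`. For non-random `Z` and `v` this says that
`‖P_{m n}^⊥ (v n)‖² = o(k n)`. -/
def WeaklySparse {Ω : ℕ → Type*} [∀ n, MeasurableSpace (Ω n)] (P : ∀ n, Measure (Ω n))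
    {p : ℕ → ℕ} (Z : ∀ n, Ω n → Matrix (Fin n) (Fin (p n)) ℝ)
    (v : ∀ n, Ω n → EuclideanSpace ℝ (Fin n)) (s : ℕ → ℕ) (k : ℕ → ℝ) : Prop :=
  ∃ m : ∀ n, Finset (Fin (p n)), (∀ n, m n ∈ models (p n) (s n)) ∧
    IsLittleOInProb P (fun n ω => residualSq (Z n ω) (m n) (v n ω)) k

/-! ### The exponential-weights estimator -/

section Estimator

variable {n p : ℕ}

/-- The (Moore-Penrose) generalized inverse of the Gram matrix `AᵀA`: its nonzero eigenvalues are
inverted and its zero eigenvalues are kept, since `0⁻¹ = 0`. -/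
def gramInv {ι : Type*} [Fintype ι] [DecidableEq ι] (A : Matrix (Fin n) ι ℝ) : Matrix ι ι ℝ :=
  (Matrix.isHermitian_conjTranspose_mul_self A).cfc (fun x => x⁻¹)

/-- The least-squares coefficients `(Z_mᵀ Z_m)⁻¹ Z_mᵀ Y` as a vector in `ℝ^p` supported on `m`. -/
def lsCoef (Z : Matrix (Fin n) (Fin p) ℝ) (m : Finset (Fin p))
    (Y : EuclideanSpace ℝ (Fin n)) : Fin p → ℝ :=
  fun j => if hj : j ∈ m then
    (gramInv (subMatrix Z m) *ᵥ ((subMatrix Z m)ᵀ *ᵥ (fun i => Y i))) ⟨j, hj⟩ else 0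

/-- The exponential weight of the model `m` among all models of size `u`. -/
def ewWeight (α : ℝ) (u : ℕ) (Z : Matrix (Fin n) (Fin p) ℝ) (Y : EuclideanSpace ℝ (Fin n))
    (m : Finset (Fin p)) : ℝ :=
  Real.exp (-(1 / α) * residualSq Z m Y) /
    ∑ k ∈ models p u, Real.exp (-(1 / α) * residualSq Z k Y)

/-- The exponentially weighted coefficient vector. -/
def ewCoef (α : ℝ) (u : ℕ) (Z : Matrix (Fin n) (Fin p) ℝ) (Y : EuclideanSpace ℝ (Fin n)) :
    Fin p → ℝ :=
  ∑ m ∈ models p u, ewWeight α u Z Y m • lsCoef Z m Y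

/-- The residual of `Y` after subtracting the exponential-weights fitted values. -/
def ewResidual (α : ℝ) (u : ℕ) (Z : Matrix (Fin n) (Fin p) ℝ) (Y : EuclideanSpace ℝ (Fin n)) :
    EuclideanSpace ℝ (Fin n) :=
  Y - WithLp.toLp 2 (Z *ᵥ ewCoef α u Z Y)

/-- The residual-on-residual estimator of `β`. -/
def betaEW (αY αX : ℝ) (uθ uδ : ℕ) (Z : Matrix (Fin n) (Fin p) ℝ)
    (X Y : EuclideanSpace ℝ (Fin n)) : ℝ :=
  inner ℝ (ewResidual αX uδ Z X) (ewResidual αY uθ Z Y) / ‖ewResidual αX uδ Z X‖ ^ 2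

end Estimator

/-! ### The semiparametric information bound under Gaussian noise -/

section Information

variable {n p : ℕ}

/-- The log-likelihood at `y` of the law `N(m, σ² I_n)`. -/
def gaussianLogLik (σ : ℝ≥0) (m y : EuclideanSpace ℝ (Fin n)) : ℝ :=
  ∑ i, Real.log (gaussianPDFReal (m i) (σ ^ 2) (y i))

/-- The score at `t = 0` of the one-dimensional submodel `y ~ N(x (β + t) + (g + t h), σ² I_n)`. -/
def submodelScore (σ : ℝ≥0) (β : ℝ) (x g h y : EuclideanSpace ℝ (Fin n)) : ℝ :=
  deriv (fun t : ℝ => gaussianLogLik σ ((β + t) • x + (g + t • h)) y) 0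

/-- The Fisher information for `β` of the submodel in the nuisance direction `h`. -/
def submodelInfo {Ω : Type*} [MeasurableSpace Ω] (P : Measure Ω) (σ : ℝ≥0) (β : ℝ)
    (X g h Y : Ω → EuclideanSpace ℝ (Fin n)) : ℝ≥0∞ :=
  ∫⁻ ω, ENNReal.ofReal (submodelScore σ β (X ω) (g ω) (h ω) (Y ω) ^ 2) ∂P

/-- The semiparametric information bound (per observation) for `β` in the partially linear model
with Gaussian noise: the supremum over all one-dimensional submodels through the truth of the
inverse average information per observation. The nuisance directions are all measurable functions
of the variables `W`, which carry the covariates and the conditional means. -/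
def informationBound {Ω 𝓦 : Type*} [MeasurableSpace Ω] [MeasurableSpace 𝓦] (P : Measure Ω)
    (σ : ℝ≥0) (β : ℝ) (W : Ω → 𝓦) (X g Y : Ω → EuclideanSpace ℝ (Fin n)) : ℝ≥0∞ :=
  ⨆ (φ : 𝓦 → EuclideanSpace ℝ (Fin n)) (_ : Measurable φ),
    (n : ℝ≥0∞) / submodelInfo P σ β X g (fun ω => φ (W ω)) Y

end Information

end ExpWeights

end

noncomputable section

namespace ExpWeights

/-! ### Least-squares fits as projections, and the exponential weights -/

section LinearAlgebra

variable {n p : ℕ}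

/-! The estimator sees the design only through fitted values. Each `Z_m θ̂_m` is an orthogonal
projection (`mulVec_lsCoef`), whatever the rank of `Z_m`, so no compatibility condition can enter.
Write both regressions as signal plus noise: `X = ν + η` and `Y = (βν + μ) + (βη + ε)`. For data `f
+ ξ`, the exponential-weights residual is `ξ` plus the weighted average of `P_m^⊥ f - P_m ξ`.

The core is deterministic. Let `L` bound the squared projections of the noise on all spaces `span
(Z_m, f)`, the squared approximation error of one sparse model, and `α log |𝓜_u|`. Gibbs' inequality
(`sum_gibbs_mul_le`) bounds the weighted mean residual sum of squares by that of the sparse model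
plus `α log |𝓜_u|`. Since `‖P_m^⊥ (f + ξ)‖² - ‖ξ‖²` is comparable to `‖P_m^⊥ f‖²` up to multiples of
`L`, the weighted mean of `‖P_m^⊥ f‖²` is `O(L)`. Hence the error `d = residual - ξ` satisfies `‖d‖²
= O(L)` and also `⟪ζ, d⟫ = O(L)` for noise vectors `ζ` with equally small projections
(`ewResidual_sub_noise_bounds`). The latter is far better than Cauchy–Schwarz, as `‖ζ‖` may be of
order `√n`.

Probability gives `L = o_p(√n)`: a sub-Gaussian projection on a space of dimension at most `u + 1`
has an exponential square moment, and a union bound over at most `p ^ u` models costs `u log p =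
o(√n)` (`isLittleOInProb_supProj`). Then `⟪rX, rY⟫ = β ‖rX‖² + ⟪η, ε⟫ + o_p(√n)` and `‖rX‖² = n σ_η²
+ o_p(n)`, so that `√n (β̂ - β) = ⟪η, ε⟫ / (σ_η² √n) + o_p(1)`. The central limit theorem for the
products `η_i ε_i` and Slutsky's lemma finish the first claim.

For the information bound, the score in direction `h` is `⟪ε, X + h⟫ / σ_ε²`, with second moment `E
(‖ν + h‖² + n σ_η²) / σ_ε²`. It is smallest at `h = -ν`. -/

lemma gram_mul_gramInv_mul_transpose {ι : Type*} [Fintype ι] [DecidableEq ι]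
    (A : Matrix (Fin n) ι ℝ) : Aᴴ * A * gramInv A * Aᴴ = Aᴴ := by
  set hA := Matrix.isHermitian_conjTranspose_mul_self A
  -- In an eigenbasis this reads `x * x⁻¹ * x = x`, which holds at `x = 0` too because `0⁻¹ = 0`.
  -- The right factor `A` is cancelled afterwards: `B * (Aᴴ * A) = 0` forces `B * Aᴴ = 0`.
  have key : Aᴴ * A * gramInv A * (Aᴴ * A) = Aᴴ * A := by
    conv_lhs => rw [hA.spectral_theorem]
    unfold gramInv Matrix.IsHermitian.cfc
    rw [← map_mul, ← map_mul]
    conv_rhs => rw [hA.spectral_theorem]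
    congr 1
    rw [Matrix.diagonal_mul_diagonal, Matrix.diagonal_mul_diagonal]
    congr 1
    ext i
    simp
  have h0 : (Aᴴ * A * gramInv A - 1) * (Aᴴ * A) = 0 := by
    rw [Matrix.sub_mul, Matrix.one_mul, key, sub_self]
  rw [Matrix.mul_conjTranspose_mul_self_eq_zero, Matrix.sub_mul, Matrix.one_mul, sub_eq_zero] at h0
  exact h0

lemma toLp_mulVec_mem_colSpace (Z : Matrix (Fin n) (Fin p) ℝ) (m : Finset (Fin p)) (c : m → ℝ) :
    WithLp.toLp 2 (subMatrix Z m *ᵥ c) ∈ colSpace Z m := by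
  have : WithLp.toLp 2 (subMatrix Z m *ᵥ c) = ∑ j, c j • WithLp.toLp 2 (Z.col j) := by
    ext i
    simp [Matrix.mulVec, dotProduct, subMatrix, mul_comm]
  rw [this]
  exact Submodule.sum_mem _ fun j _ =>
    Submodule.smul_mem _ _ (Submodule.subset_span ⟨j, j.2, rfl⟩)

lemma inner_col_eq (Z : Matrix (Fin n) (Fin p) ℝ) (m : Finset (Fin p))
    (v : EuclideanSpace ℝ (Fin n)) (j : m) :
    inner ℝ v (WithLp.toLp 2 (Z.col j)) = ((subMatrix Z m)ᵀ *ᵥ (fun i => v i)) j := by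
  simp [PiLp.inner_apply, Matrix.mulVec, dotProduct, subMatrix]

/-- The normal equations: by the Gram identity the least-squares residual is orthogonal to every
column of `Z_m`, and this characterizes the projection even if `Z_m` is rank deficient. -/
lemma mulVec_lsCoef (Z : Matrix (Fin n) (Fin p) ℝ) (m : Finset (Fin p))
    (Y : EuclideanSpace ℝ (Fin n)) :
    WithLp.toLp 2 (Z *ᵥ lsCoef Z m Y) = (colSpace Z m).starProjection Y := by
  set A := subMatrix Z m
  have h1 : Z *ᵥ lsCoef Z m Y = A *ᵥ (gramInv A *ᵥ (Aᵀ *ᵥ (fun i => Y i))) := by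
    ext i
    simp only [Matrix.mulVec, dotProduct]
    rw [← Finset.sum_subset (Finset.subset_univ m), ← Finset.sum_coe_sort]
    · refine Finset.sum_congr rfl fun j _ => ?_
      simp only [lsCoef, j.2, dif_pos]
      rfl
    · intro j _ hj
      simp [lsCoef, hj]
  rw [h1]
  refine (Submodule.eq_starProjection_of_mem_of_inner_eq_zero
    (toLp_mulVec_mem_colSpace Z m _) fun w hw => ?_).symm
  induction hw using Submodule.span_induction with
  | mem x hx =>
    obtain ⟨j, hj, rfl⟩ := hx
    rw [inner_col_eq Z m _ ⟨j, hj⟩]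
    have := congrFun (congrArg (fun M => M *ᵥ (fun i => Y i))
      (gram_mul_gramInv_mul_transpose A)) ⟨j, hj⟩
    simp only [Matrix.conjTranspose_eq_transpose_of_trivial] at this
    have h2 : (fun i => (Y - WithLp.toLp 2 (A *ᵥ (gramInv A *ᵥ (Aᵀ *ᵥ (fun i => Y i))))) i)
      = (fun i => Y i) - A *ᵥ (gramInv A *ᵥ (Aᵀ *ᵥ (fun i => Y i))) := by
      ext i; simp
    rw [h2, Matrix.mulVec_sub, Pi.sub_apply, sub_eq_zero]
    rw [← this]
    simp [A, Matrix.mulVec_mulVec, Matrix.mul_assoc]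
  | zero => simp
  | add x y _ _ hx hy => rw [inner_add_right, hx, hy, add_zero]
  | smul a x _ hx => rw [inner_smul_right, hx, mul_zero]

lemma ewResidual_eq (α : ℝ) (u : ℕ) (Z : Matrix (Fin n) (Fin p) ℝ)
    (Y : EuclideanSpace ℝ (Fin n)) :
    ewResidual α u Z Y =
      Y - ∑ m ∈ models p u, ewWeight α u Z Y m • (colSpace Z m).starProjection Y := by
  unfold ewResidual ewCoef
  congr 1
  simp_rw [← mulVec_lsCoef]
  ext i
  simp [Matrix.mulVec_sum, Matrix.mulVec_smul]

lemma ewWeight_nonneg (α : ℝ) (u : ℕ) (Z : Matrix (Fin n) (Fin p) ℝ)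
    (Y : EuclideanSpace ℝ (Fin n)) (m : Finset (Fin p)) : 0 ≤ ewWeight α u Z Y m :=
  div_nonneg (Real.exp_nonneg _) (Finset.sum_nonneg fun _ _ => Real.exp_nonneg _)

lemma models_nonempty {p u : ℕ} (h : u ≤ p) : (models p u).Nonempty :=
  Finset.powersetCard_nonempty.2 (by simpa using h)

lemma sum_ewWeight (α : ℝ) {u : ℕ} (Z : Matrix (Fin n) (Fin p) ℝ)
    (Y : EuclideanSpace ℝ (Fin n)) (h : u ≤ p) : ∑ m ∈ models p u, ewWeight α u Z Y m = 1 := by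
  unfold ewWeight
  rw [← Finset.sum_div]
  exact div_self (Finset.sum_pos (fun _ _ => Real.exp_pos _) (models_nonempty h)).ne'

/-- Gibbs' variational inequality with the uniform prior. -/
lemma sum_gibbs_mul_le {ι : Type*} (s : Finset ι) {α : ℝ} (hα : 0 < α)
    (R : ι → ℝ) {k : ι} (hk : k ∈ s) :
    ∑ i ∈ s, Real.exp (-(1 / α) * R i) / (∑ j ∈ s, Real.exp (-(1 / α) * R j)) * R i
      ≤ R k + α * Real.log s.card := by
  obtain ⟨S, hSdef⟩ : ∃ S, S = ∑ j ∈ s, Real.exp (-(1 / α) * R j) := ⟨_, rfl⟩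
  rw [← hSdef]
  have hne : s.Nonempty := ⟨k, hk⟩
  have hS : 0 < S := hSdef ▸ Finset.sum_pos (fun _ _ => Real.exp_pos _) hne
  obtain ⟨N, hNdef⟩ : ∃ N : ℝ, N = s.card := ⟨_, rfl⟩
  have hN : 0 < N := by rw [hNdef]; exact_mod_cast hne.card_pos
  rw [← hNdef]
  have hαc (x : ℝ) : α * (-(1 / α) * x) = - x := by
    rw [← mul_assoc, mul_neg, mul_one_div_cancel hα.ne', neg_one_mul]
  have hw1 : ∑ i ∈ s, Real.exp (-(1 / α) * R i) / S = 1 := by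
    rw [← Finset.sum_div, ← hSdef]; exact div_self hS.ne'
  have hSk : -(1 / α) * R k ≤ Real.log S := by
    rw [Real.le_log_iff_exp_le hS, hSdef]
    exact Finset.single_le_sum (f := fun j => Real.exp (-(1 / α) * R j))
      (fun _ _ => (Real.exp_pos _).le) hk
  -- Termwise form of the nonnegativity of the relative entropy of the weights with respect to the
  -- uniform law. Put `R i = -α (log w + log S)` and bound `-w log w` through `log x ≤ x - 1` at `x
  -- = 1 / (N w)`.
  have hi : ∀ i ∈ s, Real.exp (-(1 / α) * R i) / S * R i ≤
      α * (Real.exp (-(1 / α) * R i) / S * (Real.log N - Real.log S - 1) + 1 / N) := by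
    intro i _
    obtain ⟨w, hwdef⟩ : ∃ w, w = Real.exp (-(1 / α) * R i) / S := ⟨_, rfl⟩
    have hw : 0 < w := hwdef ▸ div_pos (Real.exp_pos _) hS
    have h2 : R i = -α * (Real.log w + Real.log S) := by
      rw [hwdef, Real.log_div (Real.exp_pos _).ne' hS.ne', Real.log_exp, sub_add_cancel,
        neg_mul, hαc, neg_neg]
    have h3 := Real.log_le_sub_one_of_pos (x := 1 / (N * w)) (by positivity)
    rw [Real.log_div one_ne_zero (by positivity), Real.log_one,
      Real.log_mul hN.ne' hw.ne'] at h3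
    have h4 := mul_le_mul_of_nonneg_left h3 hw.le
    have h5 : w * (1 / (N * w) - 1) = 1 / N - w := by field_simp
    rw [h5] at h4
    have h6 := mul_le_mul_of_nonneg_left h4 hα.le
    rw [← hwdef, h2]
    linarith
  refine (Finset.sum_le_sum hi).trans ?_
  rw [← Finset.mul_sum, Finset.sum_add_distrib, ← Finset.sum_mul, hw1, Finset.sum_const,
    nsmul_eq_mul, ← hNdef, mul_one_div_cancel hN.ne']
  have h7 := mul_le_mul_of_nonneg_left hSk hα.le
  rw [hαc] at h7
  linarith

end LinearAlgebra

/-! ### Deterministic oracle inequality on the event of small noise projections -/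

section Oracle

variable {n p : ℕ}

/-- The column space of `Z_m` enlarged by the vector `f`. -/
def augSpace (Z : Matrix (Fin n) (Fin p) ℝ) (m : Finset (Fin p))
    (f : EuclideanSpace ℝ (Fin n)) : Submodule ℝ (EuclideanSpace ℝ (Fin n)) :=
  colSpace Z m ⊔ Submodule.span ℝ {f}

lemma norm_starProjection_le_of_le {E : Type*} [NormedAddCommGroup E] [InnerProductSpace ℝ E]
    [FiniteDimensional ℝ E] {K V : Submodule ℝ E} (h : K ≤ V) (x : E) :
    ‖K.starProjection x‖ ≤ ‖V.starProjection x‖ := by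
  rw [← Submodule.starProjection_comp_starProjection_of_le h]
  exact K.norm_starProjection_apply_le _

lemma residualSq_anti (Z : Matrix (Fin n) (Fin p) ℝ) {m m' : Finset (Fin p)} (h : m ⊆ m')
    (v : EuclideanSpace ℝ (Fin n)) : residualSq Z m' v ≤ residualSq Z m v := by
  unfold residualSq
  gcongr
  refine norm_starProjection_le_of_le (Submodule.orthogonal_le ?_) v
  exact Submodule.span_mono (Set.image_mono (by exact_mod_cast h))

variable (Z : Matrix (Fin n) (Fin p) ℝ) (m : Finset (Fin p)) (f ξ ζ : EuclideanSpace ℝ (Fin n))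

lemma orthogonal_starProjection_eq (x : EuclideanSpace ℝ (Fin n)) :
    (colSpace Z m)ᗮ.starProjection x = x - (colSpace Z m).starProjection x := by
  rw [Submodule.starProjection_orthogonal]; simp

/-- `P_m^⊥ f = f - P_m f` lies in `span (Z_m, f)`, so only the projection of `ζ` on that
low-dimensional space matters. This is why the column space is enlarged by `f`: one projection bound
controls both the cross term and `P_m ζ`. -/
lemma abs_inner_orthogonal_starProjection_le :
    |inner ℝ ζ ((colSpace Z m)ᗮ.starProjection f)| ≤
      ‖(augSpace Z m f).starProjection ζ‖ * ‖(colSpace Z m)ᗮ.starProjection f‖ := by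
  have hmem : (colSpace Z m)ᗮ.starProjection f ∈ augSpace Z m f := by
    rw [orthogonal_starProjection_eq]
    refine Submodule.sub_mem _ (Submodule.mem_sup_right (Submodule.mem_span_singleton_self f))
      (Submodule.mem_sup_left (Submodule.starProjection_apply_mem _ _))
  have : inner ℝ ζ ((colSpace Z m)ᗮ.starProjection f) =
      inner ℝ ((augSpace Z m f).starProjection ζ) ((colSpace Z m)ᗮ.starProjection f) := by
    rw [Submodule.inner_starProjection_left_eq_right,
      Submodule.starProjection_eq_self_iff.2 hmem]
  rw [this]
  exact abs_real_inner_le_norm _ _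

lemma residualSq_add_sub :
    residualSq Z m (f + ξ) - ‖ξ‖ ^ 2 =
      residualSq Z m f + 2 * inner ℝ ξ ((colSpace Z m)ᗮ.starProjection f)
        - ‖(colSpace Z m).starProjection ξ‖ ^ 2 := by
  unfold residualSq
  have h1 := Submodule.norm_sq_eq_add_norm_sq_starProjection ξ (colSpace Z m)
  have h2 : inner ℝ ((colSpace Z m)ᗮ.starProjection f) ((colSpace Z m)ᗮ.starProjection ξ) =
      inner ℝ ξ ((colSpace Z m)ᗮ.starProjection f) := by
    rw [← Submodule.inner_starProjection_left_eq_right, real_inner_comm,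
      Submodule.starProjection_eq_self_iff.2 (Submodule.starProjection_apply_mem _ _)]
  rw [map_add, norm_add_sq_real, h2, h1]
  ring

variable {Z m f ξ}

/-- The large term `‖ξ‖²` is the same for every model and is removed. With `a = ‖P_m^⊥ f‖` and `b² ≤
L`, the cross term is absorbed by `2ab ≤ a²/2 + 2b²` from below and `2ab ≤ a² + b²` from above. -/
lemma residualSq_add_bounds {L : ℝ} (hξ : ‖(augSpace Z m f).starProjection ξ‖ ^ 2 ≤ L) :
    residualSq Z m f / 2 - 3 * L ≤ residualSq Z m (f + ξ) - ‖ξ‖ ^ 2 ∧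
      residualSq Z m (f + ξ) - ‖ξ‖ ^ 2 ≤ 2 * residualSq Z m f + L := by
  have h1 := abs_le.1 (abs_inner_orthogonal_starProjection_le Z m f ξ)
  have h2 : ‖(colSpace Z m).starProjection ξ‖ ^ 2 ≤ L :=
    (pow_le_pow_left₀ (norm_nonneg _) (norm_starProjection_le_of_le le_sup_left ξ) 2).trans hξ
  rw [residualSq_add_sub]
  unfold residualSq
  set a := ‖(colSpace Z m)ᗮ.starProjection f‖
  set b := ‖(augSpace Z m f).starProjection ξ‖
  constructor
  · nlinarith [sq_nonneg (a - 2 * b)]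
  · nlinarith [sq_nonneg (a - b), sq_nonneg ‖(colSpace Z m).starProjection ξ‖]

/-- Since the weights sum to one, the error is a weighted average of bias `P_m^⊥ f` minus
overfitting `P_m ξ`. -/
lemma ewResidual_sub_noise {α : ℝ} {u : ℕ} (hu : u ≤ p) :
    ewResidual α u Z (f + ξ) - ξ = ∑ m ∈ models p u, ewWeight α u Z (f + ξ) m •
      ((colSpace Z m)ᗮ.starProjection f - (colSpace Z m).starProjection ξ) := by
  have h : f = ∑ m ∈ models p u, ewWeight α u Z (f + ξ) m • f := by
    rw [← Finset.sum_smul, sum_ewWeight α Z _ hu, one_smul]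
  rw [ewResidual_eq, add_sub_right_comm, add_sub_cancel_right]
  conv_lhs => enter [1]; rw [h]
  rw [← Finset.sum_sub_distrib]
  refine Finset.sum_congr rfl fun m _ => ?_
  rw [← smul_sub, orthogonal_starProjection_eq, map_add]
  congr 1
  abel

/-- The oracle inequality for the expected approximation error under the exponential weights. -/
lemma sum_ewWeight_mul_residualSq_le {α L : ℝ} {u s : ℕ} (hα : 0 < α) (hsu : s ≤ u) (hu : u ≤ p)
    (hξ : ∀ m ∈ models p u, ‖(augSpace Z m f).starProjection ξ‖ ^ 2 ≤ L)
    {m₀ : Finset (Fin p)} (hm₀ : m₀ ∈ models p s) (hf : residualSq Z m₀ f ≤ L)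
    (hN : α * Real.log (models p u).card ≤ L) :
    ∑ m ∈ models p u, ewWeight α u Z (f + ξ) m * residualSq Z m f ≤ 14 * L := by
  -- The weights live on models of size exactly `u`, so the sparse model is padded; enlarging it can
  -- only decrease the approximation error.
  obtain ⟨m₁, h01, hm₁⟩ := Finset.exists_superset_card_eq (s := m₀) (n := u)
    ((Finset.mem_powersetCard.1 hm₀).2.le.trans hsu) (by simpa using hu)
  have hm₁' : m₁ ∈ models p u := Finset.mem_powersetCard.2 ⟨Finset.subset_univ _, hm₁⟩
  have hf₁ := (residualSq_anti Z h01 f).trans hf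
  have h1 := sum_gibbs_mul_le (models p u) hα (fun m => residualSq Z m (f + ξ)) hm₁'
  change ∑ m ∈ models p u, ewWeight α u Z (f + ξ) m * residualSq Z m (f + ξ) ≤ _ at h1
  have h2 : ∑ m ∈ models p u, ewWeight α u Z (f + ξ) m *
      (residualSq Z m f / 2 - 3 * L + ‖ξ‖ ^ 2) ≤
      ∑ m ∈ models p u, ewWeight α u Z (f + ξ) m * residualSq Z m (f + ξ) := by
    refine Finset.sum_le_sum fun m hm => ?_
    refine mul_le_mul_of_nonneg_left ?_ (ewWeight_nonneg _ _ _ _ _)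
    linarith [(residualSq_add_bounds (hξ m hm)).1]
  have h3 : ∑ m ∈ models p u, ewWeight α u Z (f + ξ) m *
      (residualSq Z m f / 2 - 3 * L + ‖ξ‖ ^ 2) =
      (∑ m ∈ models p u, ewWeight α u Z (f + ξ) m * residualSq Z m f) / 2
        - 3 * L + ‖ξ‖ ^ 2 := by
    rw [Finset.sum_div]
    simp_rw [mul_add, mul_sub, Finset.sum_add_distrib, Finset.sum_sub_distrib, ← Finset.sum_mul,
      sum_ewWeight α Z _ hu, mul_div_assoc, one_mul]
  have h4 := (residualSq_add_bounds (hξ m₁ hm₁')).2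
  -- With `A` the weighted mean, `A/2 - 3L + ‖ξ‖² ≤ (2L + L + ‖ξ‖²) + L`, whence `A ≤ 14L`.
  linarith

/-- The norm bound is Jensen's inequality together with the orthogonality of bias and overfitting
within each model, so `14L + L`. For the inner product each model only sees the projection of `ζ` on
`span (Z_m, f)`; applying `ab ≤ (a² + b²)/2` model by model yields `14L/2 + 3L/2`, with no factor
`‖ζ‖`. -/
lemma ewResidual_sub_noise_bounds {α L : ℝ} {u s : ℕ} (hα : 0 < α) (hsu : s ≤ u) (hu : u ≤ p)
    (hξ : ∀ m ∈ models p u, ‖(augSpace Z m f).starProjection ξ‖ ^ 2 ≤ L)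
    {m₀ : Finset (Fin p)} (hm₀ : m₀ ∈ models p s) (hf : residualSq Z m₀ f ≤ L)
    (hN : α * Real.log (models p u).card ≤ L) :
    ‖ewResidual α u Z (f + ξ) - ξ‖ ^ 2 ≤ 15 * L ∧
    ∀ ζ : EuclideanSpace ℝ (Fin n),
      (∀ m ∈ models p u, ‖(augSpace Z m f).starProjection ζ‖ ^ 2 ≤ L) →
      |inner ℝ ζ (ewResidual α u Z (f + ξ) - ξ)| ≤ 15 * L := by
  have horacle := sum_ewWeight_mul_residualSq_le hα hsu hu hξ hm₀ hf hN
  have hw := sum_ewWeight α Z (f + ξ) hu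
  have hw0 := fun m => ewWeight_nonneg α u Z (f + ξ) m
  have hL : 0 ≤ L := (sq_nonneg _).trans hf
  have hproj : ∀ ζ : EuclideanSpace ℝ (Fin n), ∀ m, ‖(augSpace Z m f).starProjection ζ‖ ^ 2 ≤ L →
      ‖(colSpace Z m).starProjection ζ‖ ^ 2 ≤ L := fun ζ m h =>
    (pow_le_pow_left₀ (norm_nonneg _) (norm_starProjection_le_of_le le_sup_left ζ) 2).trans h
  rw [ewResidual_sub_noise hu]
  set w := ewWeight α u Z (f + ξ)
  constructor
  · have hconv : ConvexOn ℝ Set.univ (fun x : EuclideanSpace ℝ (Fin n) => ‖x‖ ^ 2) :=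
      convexOn_univ_norm.pow (fun _ _ => norm_nonneg _) 2
    refine (hconv.map_sum_le (fun m _ => hw0 m) hw (fun _ _ => Set.mem_univ _)).trans ?_
    have : ∀ m ∈ models p u, w m • ‖(colSpace Z m)ᗮ.starProjection f
        - (colSpace Z m).starProjection ξ‖ ^ 2 ≤ w m * residualSq Z m f + w m * L := by
      intro m hm
      rw [smul_eq_mul, ← mul_add]
      refine mul_le_mul_of_nonneg_left ?_ (hw0 m)
      have h0 : inner ℝ ((colSpace Z m)ᗮ.starProjection f)
          ((colSpace Z m).starProjection ξ) = 0 :=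
        Submodule.inner_left_of_mem_orthogonal (Submodule.starProjection_apply_mem _ _)
          (Submodule.starProjection_apply_mem _ _)
      rw [norm_sub_sq_real, h0]
      have := hproj ξ m (hξ m hm)
      unfold residualSq
      linarith
    refine (Finset.sum_le_sum this).trans ?_
    rw [Finset.sum_add_distrib, ← Finset.sum_mul, hw]
    linarith
  · intro ζ hζ
    rw [inner_sum]
    refine (Finset.abs_sum_le_sum_abs _ _).trans ?_
    have : ∀ m ∈ models p u, |inner ℝ ζ (w m • ((colSpace Z m)ᗮ.starProjection f
        - (colSpace Z m).starProjection ξ))| ≤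
        w m * residualSq Z m f * (1 / 2) + w m * (3 / 2 * L) := by
      intro m hm
      rw [inner_smul_right, abs_mul, abs_of_nonneg (hw0 m), mul_assoc, ← mul_add]
      refine mul_le_mul_of_nonneg_left ?_ (hw0 m)
      rw [inner_sub_right]
      have h1 := abs_inner_orthogonal_starProjection_le Z m f ζ
      have h2 : |inner ℝ ζ ((colSpace Z m).starProjection ξ)| ≤
          ‖(colSpace Z m).starProjection ζ‖ * ‖(colSpace Z m).starProjection ξ‖ := by
        have : inner ℝ ζ ((colSpace Z m).starProjection ξ) =
            inner ℝ ((colSpace Z m).starProjection ζ) ((colSpace Z m).starProjection ξ) := by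
          rw [Submodule.inner_starProjection_left_eq_right, Submodule.starProjection_eq_self_iff.2
            (Submodule.starProjection_apply_mem _ _)]
        rw [this]
        exact abs_real_inner_le_norm _ _
      have h3 := hproj ξ m (hξ m hm)
      have h4 := hproj ζ m (hζ m hm)
      have h5 := hζ m hm
      refine (abs_sub _ _).trans ?_
      unfold residualSq
      nlinarith [sq_nonneg (‖(augSpace Z m f).starProjection ζ‖
        - ‖(colSpace Z m)ᗮ.starProjection f‖),
        sq_nonneg (‖(colSpace Z m).starProjection ζ‖ - ‖(colSpace Z m).starProjection ξ‖)]
    refine (Finset.sum_le_sum this).trans ?_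
    rw [Finset.sum_add_distrib, ← Finset.sum_mul, ← Finset.sum_mul, hw]
    linarith

end Oracle

/-! ### Measurability of projections on random column spaces -/

section Measurability

/-- A Gram–Schmidt step. If `v ∈ U` the added vector is zero and the formula still holds, so
projections on random column spaces are measurable by induction on the columns, without splitting
according to rank. -/
lemma starProjection_sup_span_singleton {E : Type*} [NormedAddCommGroup E]
    [InnerProductSpace ℝ E] [FiniteDimensional ℝ E] (U : Submodule ℝ E) (v x : E) :
    (U ⊔ Submodule.span ℝ {v}).starProjection x = U.starProjection x +
      ((‖v - U.starProjection v‖ ^ 2)⁻¹ * inner ℝ (v - U.starProjection v) x) •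
        (v - U.starProjection v) := by
  set r := v - U.starProjection v
  have hrU : ∀ w ∈ U, inner ℝ r w = 0 := U.starProjection_inner_eq_zero v
  have hPU : ∀ y : E, inner ℝ r (U.starProjection y) = 0 := fun y =>
    hrU _ (U.starProjection_apply_mem y)
  have hv : v = U.starProjection v + r := (add_sub_cancel _ _).symm
  refine Submodule.eq_starProjection_of_mem_of_inner_eq_zero ?_ ?_
  · refine add_mem (Submodule.mem_sup_left (U.starProjection_apply_mem x))
      (Submodule.smul_mem _ _ (sub_mem
        (Submodule.mem_sup_right (Submodule.mem_span_singleton_self v))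
        (Submodule.mem_sup_left (U.starProjection_apply_mem v))))
  · have hU : ∀ w ∈ U, inner ℝ (x - (U.starProjection x +
        ((‖r‖ ^ 2)⁻¹ * inner ℝ r x) • r)) w = 0 := by
      intro w hw
      rw [← sub_sub, inner_sub_left, U.starProjection_inner_eq_zero x w hw,
        inner_smul_left, hrU w hw, mul_zero, sub_zero]
    have hr : inner ℝ (x - (U.starProjection x + ((‖r‖ ^ 2)⁻¹ * inner ℝ r x) • r)) r = 0 := by
      rw [inner_sub_left, inner_add_left, inner_smul_left, real_inner_comm,
        real_inner_comm r (U.starProjection x), hPU, real_inner_self_eq_norm_sq]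
      by_cases h : ‖r‖ ^ 2 = 0
      · have : r = 0 := by simpa using h
        simp [this]
      · simp only [conj_trivial]
        rw [mul_right_comm, inv_mul_cancel₀ h]
        ring
    intro w hw
    obtain ⟨a, ha, b, hb, rfl⟩ := Submodule.mem_sup.1 hw
    obtain ⟨c, rfl⟩ := Submodule.mem_span_singleton.1 hb
    rw [inner_add_right, hU a ha, zero_add, inner_smul_right]
    nth_rewrite 1 [hv]
    rw [inner_add_right, hr, hU _ (U.starProjection_apply_mem v), add_zero, mul_zero]

variable {Ω : Type*} [MeasurableSpace Ω] {n p : ℕ}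

lemma measurable_starProjection_sup_span {U : Ω → Submodule ℝ (EuclideanSpace ℝ (Fin n))}
    (hU : ∀ x : Ω → EuclideanSpace ℝ (Fin n), Measurable x →
      Measurable fun ω => (U ω).starProjection (x ω))
    {v x : Ω → EuclideanSpace ℝ (Fin n)} (hv : Measurable v) (hx : Measurable x) :
    Measurable fun ω => (U ω ⊔ Submodule.span ℝ {v ω}).starProjection (x ω) := by
  simp_rw [starProjection_sup_span_singleton]
  have hr := hv.sub (hU v hv)
  exact (hU x hx).add ((((hr.norm.pow_const 2).inv).mul (hr.inner hx)).smul hr)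

lemma colSpace_insert (Z : Matrix (Fin n) (Fin p) ℝ) (j : Fin p) (m : Finset (Fin p)) :
    colSpace Z (insert j m) = colSpace Z m ⊔ Submodule.span ℝ {WithLp.toLp 2 (Z.col j)} := by
  unfold colSpace
  rw [Finset.coe_insert, Set.image_insert_eq, Submodule.span_insert, sup_comm]

variable {Z : Ω → Matrix (Fin n) (Fin p) ℝ}

lemma measurable_toLp_col (hZ : ∀ i j, Measurable fun ω => Z ω i j) (j : Fin p) :
    Measurable fun ω => (WithLp.toLp 2 ((Z ω).col j) : EuclideanSpace ℝ (Fin n)) :=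
  (WithLp.measurable_toLp 2 _).comp (measurable_pi_lambda _ fun i => hZ i j)

lemma measurable_colSpace_starProjection (hZ : ∀ i j, Measurable fun ω => Z ω i j)
    (m : Finset (Fin p)) (x : Ω → EuclideanSpace ℝ (Fin n)) (hx : Measurable x) :
    Measurable fun ω => (colSpace (Z ω) m).starProjection (x ω) := by
  induction m using Finset.induction_on generalizing x with
  | empty => simp [colSpace]
  | insert j m _ ih =>
    simp_rw [colSpace_insert]
    exact measurable_starProjection_sup_span ih (measurable_toLp_col hZ j) hx

lemma measurable_augSpace_starProjection (hZ : ∀ i j, Measurable fun ω => Z ω i j)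
    (m : Finset (Fin p)) {f x : Ω → EuclideanSpace ℝ (Fin n)} (hf : Measurable f)
    (hx : Measurable x) :
    Measurable fun ω => (augSpace (Z ω) m (f ω)).starProjection (x ω) :=
  measurable_starProjection_sup_span (measurable_colSpace_starProjection hZ m) hf hx

lemma measurable_residualSq (hZ : ∀ i j, Measurable fun ω => Z ω i j)
    (m : Finset (Fin p)) {x : Ω → EuclideanSpace ℝ (Fin n)} (hx : Measurable x) :
    Measurable fun ω => residualSq (Z ω) m (x ω) := by
  unfold residualSq
  simp_rw [orthogonal_starProjection_eq]
  exact (hx.sub (measurable_colSpace_starProjection hZ m x hx)).norm.pow_const 2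

lemma measurable_ewResidual (hZ : ∀ i j, Measurable fun ω => Z ω i j) (α : ℝ) (u : ℕ)
    {x : Ω → EuclideanSpace ℝ (Fin n)} (hx : Measurable x) :
    Measurable fun ω => ewResidual α u (Z ω) (x ω) := by
  simp_rw [ewResidual_eq]
  have he : ∀ m, Measurable fun ω => Real.exp (-(1 / α) * residualSq (Z ω) m (x ω)) := fun m =>
    ((measurable_residualSq hZ m hx).const_mul _).exp
  refine hx.sub (Finset.measurable_sum _ fun m _ => Measurable.fun_smul ?_
    (measurable_colSpace_starProjection hZ m x hx))
  exact (he m).div (Finset.measurable_sum _ fun k _ => he k)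

lemma measurable_betaEW (hZ : ∀ i j, Measurable fun ω => Z ω i j) (αY αX : ℝ) (uθ uδ : ℕ)
    {X Y : Ω → EuclideanSpace ℝ (Fin n)} (hX : Measurable X) (hY : Measurable Y) :
    Measurable fun ω => betaEW αY αX uθ uδ (Z ω) (X ω) (Y ω) := by
  have h1 := measurable_ewResidual hZ αX uδ hX
  exact (h1.inner (measurable_ewResidual hZ αY uθ hY)).div (h1.norm.pow_const 2)

lemma finrank_augSpace_le (Z : Matrix (Fin n) (Fin p) ℝ) (m : Finset (Fin p))
    (f : EuclideanSpace ℝ (Fin n)) : Module.finrank ℝ (augSpace Z m f) ≤ m.card + 1 := by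
  classical
  refine (Submodule.finrank_add_le_finrank_add_finrank _ _).trans (add_le_add ?_ ?_)
  · unfold colSpace
    rw [← Finset.coe_image]
    exact (finrank_span_finset_le_card _).trans Finset.card_image_le
  · exact (finrank_span_le_card {f}).trans (by simp)

end Measurability

/-! ### Exponential moments and deviations of projected sub-Gaussian vectors -/

section QuadraticForm

/-- The constant `E exp (g² / 4)` for a standard Gaussian variable `g`. -/
def gaussConst : ℝ≥0∞ := ∫⁻ g, ENNReal.ofReal (Real.exp (g ^ 2 / 4)) ∂(gaussianReal 0 1)

lemma gaussConst_lt_top : gaussConst < ∞ := by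
  unfold gaussConst
  rw [gaussianReal_of_var_ne_zero 0 one_ne_zero,
    lintegral_withDensity_eq_lintegral_mul _ (measurable_gaussianPDF 0 1) (by fun_prop)]
  have hint : Integrable (fun x : ℝ => (√(2 * Real.pi * (1 : ℝ≥0)))⁻¹ *
      Real.exp (-(1 / 4) * x ^ 2)) := (integrable_exp_neg_mul_sq (by norm_num)).const_mul _
  refine lt_of_eq_of_lt (lintegral_congr fun x => ?_) hint.lintegral_lt_top
  rw [Pi.mul_apply, gaussianPDF, ← ENNReal.ofReal_mul (gaussianPDFReal_nonneg _ _ _),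
    gaussianPDFReal, mul_assoc, ← Real.exp_add]
  congr 3
  simp only [NNReal.coe_one]
  ring

lemma one_le_gaussConst : 1 ≤ gaussConst := by
  calc (1 : ℝ≥0∞) = ∫⁻ _, 1 ∂(gaussianReal 0 1) := by simp
    _ ≤ gaussConst := lintegral_mono fun g => by
        rw [← ENNReal.ofReal_one]
        exact ENNReal.ofReal_le_ofReal (Real.one_le_exp (by positivity))

lemma lintegral_exp_mul_gaussianReal (t : ℝ) :
    ∫⁻ g, ENNReal.ofReal (Real.exp (t * g)) ∂(gaussianReal 0 1) =
      ENNReal.ofReal (Real.exp (t ^ 2 / 2)) := by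
  rw [← ofReal_integral_eq_lintegral_ofReal (integrable_exp_mul_gaussianReal t)
    (ae_of_all _ fun _ => (Real.exp_pos _).le)]
  have := mgf_gaussianReal (p := gaussianReal 0 1) (X := id) (μ := 0) (v := 1) (by simp) t
  simp only [mgf, id] at this
  rw [this]
  simp

lemma lintegral_pi_prod {ι : Type*} [Fintype ι] (γ : Measure ℝ) [IsProbabilityMeasure γ]
    (F : ι → ℝ → ℝ≥0∞) (hF : ∀ i, Measurable (F i)) :
    ∫⁻ g, ∏ i, F i (g i) ∂(Measure.pi fun _ : ι => γ) = ∏ i, ∫⁻ x, F i x ∂γ := by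
  have hind : iIndepFun (fun (i : ι) (g : ι → ℝ) => F i (g i)) (Measure.pi fun _ : ι => γ) :=
    iIndepFun_pi (X := F) fun i => (hF i).aemeasurable
  rw [lintegral_prod_eq_prod_lintegral_of_indepFun Finset.univ
    (fun (i : ι) (g : ι → ℝ) => F i (g i)) hind fun i => (hF i).comp (measurable_pi_apply i)]
  refine Finset.prod_congr rfl fun i _ => ?_
  exact (measurePreserving_eval (fun _ : ι => γ) i).lintegral_comp (hF i)

variable {E : Type*} [NormedAddCommGroup E] [InnerProductSpace ℝ E] [FiniteDimensional ℝ E]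
  [MeasurableSpace E] [BorelSpace E]

/-- The exponential moment of the squared norm of a projected sub-Gaussian vector. -/
lemma lintegral_exp_sq_norm_starProjection_le (ρ : Measure E) [IsProbabilityMeasure ρ]
    {K s : ℝ} (hs : s ^ 2 * K ^ 2 ≤ 1 / 2)
    (hρ : ∀ v : E, ∫⁻ x, ENNReal.ofReal (Real.exp (inner ℝ v x)) ∂ρ ≤
      ENNReal.ofReal (Real.exp (K ^ 2 * ‖v‖ ^ 2 / 2))) (V : Submodule ℝ E) :
    ∫⁻ x, ENNReal.ofReal (Real.exp (s ^ 2 / 2 * ‖V.starProjection x‖ ^ 2)) ∂ρ ≤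
      gaussConst ^ Module.finrank ℝ V := by
  set d := Module.finrank ℝ V
  let b : OrthonormalBasis (Fin d) ℝ V := stdOrthonormalBasis ℝ V
  let γ : Measure (Fin d → ℝ) := Measure.pi fun _ => gaussianReal 0 1
  have hnorm : ∀ x : E, ‖V.starProjection x‖ ^ 2 = ∑ j, (inner ℝ (b j : E) x) ^ 2 := by
    intro x
    rw [Submodule.starProjection_apply, ← Submodule.coe_norm, ← b.sum_sq_norm_inner_right]
    refine Finset.sum_congr rfl fun j _ => ?_
    rw [Real.norm_eq_abs, sq_abs, ← Submodule.inner_orthogonalProjectionOnto_eq_of_mem_left]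
  have hb : Orthonormal ℝ fun j => (b j : E) := b.orthonormal.comp_linearIsometry V.subtypeₗᵢ
  -- Gaussian linearization: `exp (s²|y|²/2)` is the mean of `exp (s⟪g, y⟫)` over a standard
  -- Gaussian `g`. After exchanging the integrals, the sub-Gaussian bound applies to a linear
  -- functional of `x`, and `s²K² ≤ 1/2` leaves at most `exp (|g|²/4)`, which is integrable.
  have hlin : ∀ x : E, ENNReal.ofReal (Real.exp (s ^ 2 / 2 * ‖V.starProjection x‖ ^ 2)) =
      ∫⁻ g, ENNReal.ofReal (Real.exp (inner ℝ (∑ j, (s * g j) • (b j : E)) x)) ∂γ := by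
    intro x
    have h1 : ∀ g : Fin d → ℝ,
        ENNReal.ofReal (Real.exp (inner ℝ (∑ j, (s * g j) • (b j : E)) x)) =
        ∏ j, ENNReal.ofReal (Real.exp ((s * inner ℝ (b j : E) x) * g j)) := by
      intro g
      rw [← ENNReal.ofReal_prod_of_nonneg fun _ _ => (Real.exp_pos _).le, ← Real.exp_sum,
        sum_inner]
      congr 2
      refine Finset.sum_congr rfl fun j _ => ?_
      rw [real_inner_smul_left]
      ring
    simp_rw [h1]
    rw [lintegral_pi_prod (gaussianReal 0 1)
      (fun j y => ENNReal.ofReal (Real.exp ((s * inner ℝ (b j : E) x) * y)))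
      fun j => by fun_prop]
    simp_rw [lintegral_exp_mul_gaussianReal]
    rw [← ENNReal.ofReal_prod_of_nonneg fun _ _ => (Real.exp_pos _).le, ← Real.exp_sum,
      hnorm, Finset.mul_sum]
    congr 2
    refine Finset.sum_congr rfl fun j _ => ?_
    ring
  simp_rw [hlin]
  rw [lintegral_lintegral_swap (by fun_prop)]
  calc ∫⁻ g, ∫⁻ x, ENNReal.ofReal (Real.exp (inner ℝ (∑ j, (s * g j) • (b j : E)) x)) ∂ρ ∂γ
      ≤ ∫⁻ g, ∏ j, ENNReal.ofReal (Real.exp (g j ^ 2 / 4)) ∂γ := by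
        refine lintegral_mono fun g => (hρ _).trans ?_
        rw [← ENNReal.ofReal_prod_of_nonneg fun _ _ => (Real.exp_pos _).le, ← Real.exp_sum]
        refine ENNReal.ofReal_le_ofReal (Real.exp_le_exp.2 ?_)
        have h2 : ‖∑ j, (s * g j) • (b j : E)‖ ^ 2 = s ^ 2 * ∑ j, g j ^ 2 := by
          rw [← real_inner_self_eq_norm_sq, hb.inner_sum, Finset.mul_sum]
          refine Finset.sum_congr rfl fun j _ => ?_
          simp only [conj_trivial]
          ring
        rw [h2, ← Finset.sum_div]
        have h3 : 0 ≤ ∑ j, g j ^ 2 := Finset.sum_nonneg fun _ _ => sq_nonneg _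
        nlinarith
    _ = gaussConst ^ d := by
        rw [lintegral_pi_prod (gaussianReal 0 1)
          (fun _ y => ENNReal.ofReal (Real.exp (y ^ 2 / 4))) fun _ => by fun_prop]
        simp [gaussConst]

/-- A deviation bound for the projection on a random subspace that is independent of the noise. -/
lemma measure_sq_norm_starProjection_gt_le {Ω 𝓦 : Type*} [MeasurableSpace Ω] [MeasurableSpace 𝓦]
    (P : Measure Ω) [IsProbabilityMeasure P] {W : Ω → 𝓦} {ζ : Ω → E} (hW : Measurable W)
    (hζ : Measurable ζ) (hind : IndepFun W ζ P) {K s : ℝ} (hs : s ^ 2 * K ^ 2 ≤ 1 / 2)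
    (hK : ∀ v : E, ∫⁻ ω, ENNReal.ofReal (Real.exp (inner ℝ v (ζ ω))) ∂P ≤
      ENNReal.ofReal (Real.exp (K ^ 2 * ‖v‖ ^ 2 / 2)))
    {V : 𝓦 → Submodule ℝ E} (hV : Measurable fun x : 𝓦 × E => (V x.1).starProjection x.2)
    {d : ℕ} (hd : ∀ w, Module.finrank ℝ (V w) ≤ d) (κ : ℝ) :
    P {ω | κ < ‖(V (W ω)).starProjection (ζ ω)‖ ^ 2} ≤
      gaussConst ^ d * ENNReal.ofReal (Real.exp (-(s ^ 2 / 2 * κ))) := by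
  have hint : ∫⁻ ω, ENNReal.ofReal
      (Real.exp (s ^ 2 / 2 * ‖(V (W ω)).starProjection (ζ ω)‖ ^ 2)) ∂P ≤ gaussConst ^ d := by
    have hm : Measurable fun x : 𝓦 × E => ENNReal.ofReal
        (Real.exp (s ^ 2 / 2 * ‖(V x.1).starProjection x.2‖ ^ 2)) := by fun_prop
    have : ∫⁻ ω, ENNReal.ofReal
        (Real.exp (s ^ 2 / 2 * ‖(V (W ω)).starProjection (ζ ω)‖ ^ 2)) ∂P =
        ∫⁻ x, ENNReal.ofReal (Real.exp (s ^ 2 / 2 * ‖(V x.1).starProjection x.2‖ ^ 2))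
          ∂(P.map fun ω => (W ω, ζ ω)) := by
      rw [lintegral_map hm (hW.prodMk hζ)]
    -- Under the product law `W` can be frozen, so the bound for a deterministic subspace applies
    -- and is then integrated over `W`.
    rw [this, (indepFun_iff_map_prod_eq_prod_map_map hW.aemeasurable hζ.aemeasurable).1 hind]
    have := Measure.isProbabilityMeasure_map (μ := P) hW.aemeasurable
    have := Measure.isProbabilityMeasure_map (μ := P) hζ.aemeasurable
    rw [lintegral_prod _ hm.aemeasurable]
    calc _ ≤ ∫⁻ _, gaussConst ^ d ∂(P.map W) := by
          refine lintegral_mono fun w => ?_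
          refine (lintegral_exp_sq_norm_starProjection_le (P.map ζ) hs (fun v => ?_) (V w)).trans
            (pow_le_pow_right₀ one_le_gaussConst (hd w))
          rw [lintegral_map (by fun_prop) hζ]
          exact hK v
      _ = gaussConst ^ d := by simp
  have hm : Measurable fun ω => ENNReal.ofReal
      (Real.exp (s ^ 2 / 2 * ‖(V (W ω)).starProjection (ζ ω)‖ ^ 2)) := by
    have := hV.comp (hW.prodMk hζ)
    simp only [Function.comp_def] at this
    fun_prop
  have hmarkov := mul_meas_ge_le_lintegral (μ := P) hm
    (ENNReal.ofReal (Real.exp (s ^ 2 / 2 * κ)))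
  have hsub : P {ω | κ < ‖(V (W ω)).starProjection (ζ ω)‖ ^ 2} ≤
      P {ω | ENNReal.ofReal (Real.exp (s ^ 2 / 2 * κ)) ≤ ENNReal.ofReal
      (Real.exp (s ^ 2 / 2 * ‖(V (W ω)).starProjection (ζ ω)‖ ^ 2))} := by
    refine measure_mono fun ω hω => ENNReal.ofReal_le_ofReal (Real.exp_le_exp.2 ?_)
    exact mul_le_mul_of_nonneg_left (le_of_lt hω) (by positivity)
  have hinv : ENNReal.ofReal (Real.exp (-(s ^ 2 / 2 * κ))) *
      ENNReal.ofReal (Real.exp (s ^ 2 / 2 * κ)) = 1 := by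
    rw [← ENNReal.ofReal_mul (Real.exp_pos _).le, ← Real.exp_add]
    simp
  calc P {ω | κ < ‖(V (W ω)).starProjection (ζ ω)‖ ^ 2}
      = ENNReal.ofReal (Real.exp (-(s ^ 2 / 2 * κ))) * (ENNReal.ofReal (Real.exp (s ^ 2 / 2 * κ))
        * P {ω | κ < ‖(V (W ω)).starProjection (ζ ω)‖ ^ 2}) := by
        rw [← mul_assoc, hinv, one_mul]
    _ ≤ ENNReal.ofReal (Real.exp (-(s ^ 2 / 2 * κ))) * gaussConst ^ d := by
        gcongr
        exact (mul_le_mul_right hsub _).trans (hmarkov.trans hint)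
    _ = _ := mul_comm _ _

end QuadraticForm

/-! ### Calculus of `o_p` -/

section StochasticOrder

variable {Ω : ℕ → Type*} [∀ n, MeasurableSpace (Ω n)] {P : ∀ n, Measure (Ω n)}

/-- A variable that is small whenever finitely many `o_p` variables are small is itself `o_p`. -/
lemma IsLittleOInProb.of_forall_imp {ι : Type*} [Fintype ι] {V : ι → ∀ n, Ω n → ℝ}
    {r : ι → ℕ → ℝ} (hV : ∀ i, IsLittleOInProb P (V i) (r i)) {W : ∀ n, Ω n → ℝ} {r' : ℕ → ℝ}
    (h : ∀ κ > 0, ∃ δ > 0, ∀ᶠ n in atTop, ∀ ω, (∀ i, |V i n ω| ≤ δ * r i n) →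
      |W n ω| ≤ κ * r' n) :
    IsLittleOInProb P W r' := by
  intro κ hκ
  obtain ⟨δ, hδ, hev⟩ := h κ hκ
  have hlim : Tendsto (fun n => ∑ i, P n {ω | δ * r i n < |V i n ω|}) atTop (𝓝 0) := by
    simpa using tendsto_finsetSum Finset.univ fun i _ => hV i δ hδ
  refine tendsto_of_tendsto_of_tendsto_of_le_of_le' tendsto_const_nhds hlim
    (Eventually.of_forall fun _ => zero_le) ?_
  filter_upwards [hev] with n hn
  refine (measure_mono (t := ⋃ i, {ω | δ * r i n < |V i n ω|}) fun ω hω => ?_).trans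
    (measure_iUnion_fintype_le _ _)
  by_contra hcon
  simp only [Set.mem_iUnion, Set.mem_ofPred_eq, not_exists, not_lt] at hcon
  exact absurd (hn ω hcon) (not_le.2 hω)

end StochasticOrder

/-! ### Maximal projection over all models of a given size -/

section Maximal

/-- The largest squared norm of a projection of `ζ` on the spaces `span (Z_m, f)`. -/
def supProj {n p : ℕ} (u : ℕ) (Z : Matrix (Fin n) (Fin p) ℝ)
    (f ζ : EuclideanSpace ℝ (Fin n)) : ℝ :=
  ((models p u).sup fun m => ‖(augSpace Z m f).starProjection ζ‖₊ ^ 2 : ℝ≥0)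

lemma sq_norm_le_supProj {n p u : ℕ} (Z : Matrix (Fin n) (Fin p) ℝ)
    (f ζ : EuclideanSpace ℝ (Fin n)) {m : Finset (Fin p)} (hm : m ∈ models p u) :
    ‖(augSpace Z m f).starProjection ζ‖ ^ 2 ≤ supProj u Z f ζ := by
  have := Finset.le_sup (f := fun m => ‖(augSpace Z m f).starProjection ζ‖₊ ^ 2) hm
  exact_mod_cast this

/-- The supremum is taken in `ℝ≥0`, hence is `0` over an empty family; `0 ≤ κ` excludes that case.
-/
lemma exists_of_lt_supProj {n p u : ℕ} {Z : Matrix (Fin n) (Fin p) ℝ}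
    {f ζ : EuclideanSpace ℝ (Fin n)} {κ : ℝ} (hκ : 0 ≤ κ) (h : κ < supProj u Z f ζ) :
    ∃ m ∈ models p u, κ < ‖(augSpace Z m f).starProjection ζ‖ ^ 2 := by
  lift κ to ℝ≥0 using hκ
  unfold supProj at h
  rw [NNReal.coe_lt_coe, Finset.lt_sup_iff] at h
  obtain ⟨m, hm, hlt⟩ := h
  exact ⟨m, hm, by exact_mod_cast hlt⟩

lemma card_models_le (p u : ℕ) : (models p u).card ≤ p ^ u := by
  rw [models, Finset.card_powersetCard, Finset.card_univ, Fintype.card_fin]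
  exact Nat.choose_le_pow p u

variable {Ω : Type*} [MeasurableSpace Ω] {P : Measure Ω} {n : ℕ}

lemma lintegral_exp_inner_le {ζ : Ω → EuclideanSpace ℝ (Fin n)} (hζ : Measurable ζ)
    (hind : iIndepFun (fun i ω => ζ ω i) P) {K : ℝ≥0}
    (hK : ∀ i, HasSubgaussianMGF (fun ω => ζ ω i) (K ^ 2) P) (v : EuclideanSpace ℝ (Fin n)) :
    ∫⁻ ω, ENNReal.ofReal (Real.exp (inner ℝ v (ζ ω))) ∂P ≤
      ENNReal.ofReal (Real.exp (K ^ 2 * ‖v‖ ^ 2 / 2)) := by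
  have hm : ∀ i, Measurable fun ω => ζ ω i := fun i => by fun_prop
  have h1 : ∀ ω, ENNReal.ofReal (Real.exp (inner ℝ v (ζ ω))) =
      ∏ i, ENNReal.ofReal (Real.exp (v i * ζ ω i)) := by
    intro ω
    rw [← ENNReal.ofReal_prod_of_nonneg fun _ _ => (Real.exp_pos _).le, ← Real.exp_sum]
    simp [PiLp.inner_apply, mul_comm]
  simp_rw [h1]
  rw [lintegral_prod_eq_prod_lintegral_of_indepFun Finset.univ
    (fun i ω => ENNReal.ofReal (Real.exp (v i * ζ ω i)))
    (hind.comp (fun i x => ENNReal.ofReal (Real.exp (v i * x))) fun i => by fun_prop)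
    fun i => by fun_prop]
  have h2 : ENNReal.ofReal (Real.exp (K ^ 2 * ‖v‖ ^ 2 / 2)) =
      ∏ i, ENNReal.ofReal (Real.exp (K ^ 2 * v i ^ 2 / 2)) := by
    rw [← ENNReal.ofReal_prod_of_nonneg fun _ _ => (Real.exp_pos _).le, ← Real.exp_sum,
      EuclideanSpace.norm_sq_eq, ← Finset.sum_div, ← Finset.mul_sum]
    simp
  rw [h2]
  refine Finset.prod_le_prod' fun i _ => ?_
  rw [← ofReal_integral_eq_lintegral_ofReal ((hK i).integrable_exp_mul (v i))
    (ae_of_all _ fun _ => (Real.exp_pos _).le)]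
  refine ENNReal.ofReal_le_ofReal ?_
  have := (hK i).mgf_le (v i)
  simpa [mgf] using this

/-- Union bound over at most `p ^ u` models, each contributing a space of dimension at most `u + 1`
that depends on `W` only. -/
lemma measure_supProj_gt_le [IsProbabilityMeasure P] {p : ℕ} {𝓦 : Type*} [MeasurableSpace 𝓦] {W : Ω → 𝓦}
    {ζ : Ω → EuclideanSpace ℝ (Fin n)} (hW : Measurable W) (hζ : Measurable ζ)
    (hindW : IndepFun W ζ P) (hind : iIndepFun (fun i ω => ζ ω i) P) {K : ℝ≥0}
    (hK : ∀ i, HasSubgaussianMGF (fun ω => ζ ω i) (K ^ 2) P)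
    {s : ℝ} (hs : s ^ 2 * (K : ℝ) ^ 2 ≤ 1 / 2)
    {Z : 𝓦 → Matrix (Fin n) (Fin p) ℝ} {f : 𝓦 → EuclideanSpace ℝ (Fin n)}
    (hZ : ∀ i j, Measurable fun w => Z w i j) (hf : Measurable f) (u : ℕ) {κ : ℝ} (hκ : 0 ≤ κ) :
    P {ω | κ < |supProj u (Z (W ω)) (f (W ω)) (ζ ω)|} ≤
      (p : ℝ≥0∞) ^ u * (gaussConst ^ (u + 1) *
        ENNReal.ofReal (Real.exp (-(s ^ 2 / 2 * κ)))) := by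
  have hsub : {ω | κ < |supProj u (Z (W ω)) (f (W ω)) (ζ ω)|} ⊆ ⋃ m ∈ models p u,
      {ω | κ < ‖(augSpace (Z (W ω)) m (f (W ω))).starProjection (ζ ω)‖ ^ 2} := by
    intro ω hω
    have h0 : 0 ≤ supProj u (Z (W ω)) (f (W ω)) (ζ ω) := NNReal.coe_nonneg _
    simp only [Set.mem_ofPred_eq, abs_of_nonneg h0] at hω
    simpa using exists_of_lt_supProj hκ hω
  refine (measure_mono hsub).trans ((measure_biUnion_finset_le _ _).trans ?_)
  have hm : ∀ m ∈ models p u,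
      P {ω | κ < ‖(augSpace (Z (W ω)) m (f (W ω))).starProjection (ζ ω)‖ ^ 2} ≤
      gaussConst ^ (u + 1) * ENNReal.ofReal (Real.exp (-(s ^ 2 / 2 * κ))) := by
    intro m hm
    refine measure_sq_norm_starProjection_gt_le P hW hζ hindW hs
      (lintegral_exp_inner_le hζ hind hK) (V := fun w => augSpace (Z w) m (f w)) ?_
      (fun w => (finrank_augSpace_le _ _ _).trans ?_) κ
    · exact measurable_augSpace_starProjection (fun i j => (hZ i j).comp measurable_fst) m
        (hf.comp measurable_fst) measurable_snd
    · rw [(Finset.mem_powersetCard.1 hm).2]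
  refine (Finset.sum_le_sum hm).trans ?_
  rw [Finset.sum_const, nsmul_eq_mul]
  gcongr
  exact_mod_cast card_models_le p u

end Maximal

/-! ### The maximal projection is of smaller order than `√n` -/

section Asymptotic

/-- The logarithm of the union bound. Eventually `p ≥ 2`, so `u log p = o(√n)` also forces `u =
o(√n)`, and the term `-a √n` dominates. -/
lemma tendsto_exponent_atBot {p u : ℕ → ℕ} (hp : ∀ᶠ n in atTop, n < p n)
    (hu : Tendsto (fun n => u n * Real.log (p n) / √(n : ℝ)) atTop (𝓝 0)) (c : ℝ) {a : ℝ}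
    (ha : 0 < a) :
    Tendsto (fun n : ℕ => u n * Real.log (p n) + c * (u n + 1) - a * √(n : ℝ)) atTop atBot := by
  have hsq : Tendsto (fun n : ℕ => √(n : ℝ)) atTop atTop :=
    Real.tendsto_sqrt_atTop.comp tendsto_natCast_atTop_atTop
  have hu' : Tendsto (fun n => (u n : ℝ) / √(n : ℝ)) atTop (𝓝 0) := by
    have h0 : Tendsto (fun n => (Real.log 2)⁻¹ * (u n * Real.log (p n) / √(n : ℝ)))
      atTop (𝓝 0) := by simpa using hu.const_mul (Real.log 2)⁻¹
    refine tendsto_of_tendsto_of_tendsto_of_le_of_le' tendsto_const_nhds h0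
      (Eventually.of_forall fun _ => by positivity) ?_
    filter_upwards [hp, eventually_ge_atTop 1] with n hn h1
    have h2 : Real.log 2 ≤ Real.log (p n) :=
      Real.log_le_log (by norm_num) (by exact_mod_cast (by omega : 2 ≤ p n))
    have h3 : 0 < Real.log 2 := Real.log_pos (by norm_num)
    rw [← mul_div_assoc, inv_mul_eq_div]
    gcongr
    rw [le_div_iff₀ h3]
    gcongr
  have h1 : Tendsto (fun n : ℕ => 1 / √(n : ℝ)) atTop (𝓝 0) := by
    simp_rw [one_div]
    exact hsq.inv_tendsto_atTop
  have hlim : Tendsto (fun n : ℕ => u n * Real.log (p n) / √(n : ℝ) +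
      c * (u n / √(n : ℝ) + 1 / √(n : ℝ)) - a) atTop (𝓝 (-a)) := by
    simpa using (hu.add ((hu'.add h1).const_mul c)).sub_const a
  refine (hsq.atTop_mul_neg (neg_lt_zero.2 ha) hlim).congr' ?_
  filter_upwards [eventually_ge_atTop 1] with n hn
  have : √(n : ℝ) ≠ 0 := (Real.sqrt_pos.2 (by exact_mod_cast hn)).ne'
  field_simp

variable {Ω : ℕ → Type*} [∀ n, MeasurableSpace (Ω n)] {P : ∀ n, Measure (Ω n)}
  [∀ n, IsProbabilityMeasure (P n)]

/-- The maximal projection of a sub-Gaussian vector over all models of size `u` is `o_p(√n)`. -/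
lemma isLittleOInProb_supProj {p u : ℕ → ℕ} (hp : ∀ᶠ n in atTop, n < p n)
    (hu : Tendsto (fun n => u n * Real.log (p n) / √(n : ℝ)) atTop (𝓝 0))
    {𝓦 : ℕ → Type*} [∀ n, MeasurableSpace (𝓦 n)] {W : ∀ n, Ω n → 𝓦 n}
    {ζ : ∀ n, Ω n → EuclideanSpace ℝ (Fin n)} (hW : ∀ n, Measurable (W n))
    (hζ : ∀ n, Measurable (ζ n)) (hindW : ∀ n, IndepFun (W n) (ζ n) (P n))
    (hind : ∀ n, iIndepFun (fun i ω => ζ n ω i) (P n)) {K : ℝ≥0}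
    (hK : ∀ n i, HasSubgaussianMGF (fun ω => ζ n ω i) (K ^ 2) (P n))
    {Z : ∀ n, Ω n → Matrix (Fin n) (Fin (p n)) ℝ} {f : ∀ n, Ω n → EuclideanSpace ℝ (Fin n)}
    (Z' : ∀ n, 𝓦 n → Matrix (Fin n) (Fin (p n)) ℝ) (f' : ∀ n, 𝓦 n → EuclideanSpace ℝ (Fin n))
    (hZ : ∀ n ω, Z n ω = Z' n (W n ω)) (hf : ∀ n ω, f n ω = f' n (W n ω))
    (hZ' : ∀ n i j, Measurable fun w => Z' n w i j) (hf' : ∀ n, Measurable (f' n)) :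
    IsLittleOInProb P (fun n ω => supProj (u n) (Z n ω) (f n ω) (ζ n ω))
      (fun n => √(n : ℝ)) := by
  simp_rw [hZ, hf]
  intro κ hκ
  -- Any `s > 0` with `s²K² ≤ 1/2` would do; the `+ 1` covers `K = 0`.
  set s : ℝ := 1 / (2 * (K + 1))
  have hK0 : (0 : ℝ) ≤ K := K.coe_nonneg
  have hs0 : 0 < s := by positivity
  have hs : s ^ 2 * (K : ℝ) ^ 2 ≤ 1 / 2 := by
    rw [← mul_pow, one_div_mul_eq_div]
    have h1 : (K : ℝ) / (2 * (K + 1)) ≤ 1 / 2 := by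
      rw [div_le_div_iff₀ (by positivity) (by norm_num)]; linarith
    have h2 : 0 ≤ (K : ℝ) / (2 * (K + 1)) := by positivity
    nlinarith
  set c := Real.log gaussConst.toReal
  have hC : gaussConst = ENNReal.ofReal (Real.exp c) := by
    have h1 : (1 : ℝ) ≤ gaussConst.toReal := by
      rw [← ENNReal.toReal_one]
      exact ENNReal.toReal_mono gaussConst_lt_top.ne one_le_gaussConst
    rw [Real.exp_log (by linarith), ENNReal.ofReal_toReal gaussConst_lt_top.ne]
  have hlim : Tendsto (fun n : ℕ => ENNReal.ofReal (Real.exp (u n * Real.log (p n) +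
      c * (u n + 1) - s ^ 2 / 2 * κ * √(n : ℝ)))) atTop (𝓝 0) := by
    rw [← ENNReal.ofReal_zero]
    exact (ENNReal.continuous_ofReal.tendsto 0).comp
      (Real.tendsto_exp_atBot.comp (tendsto_exponent_atBot hp hu c (by positivity)))
  refine tendsto_of_tendsto_of_tendsto_of_le_of_le' tendsto_const_nhds hlim
    (Eventually.of_forall fun _ => zero_le) ?_
  filter_upwards [hp] with n hn
  refine (measure_supProj_gt_le (hW n) (hζ n) (hindW n) (hind n) (hK n) hs (hZ' n) (hf' n) (u n)
    (by positivity)).trans (le_of_eq ?_)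
  have hp0 : (0 : ℝ) < p n := by exact_mod_cast (Nat.zero_le n).trans_lt hn
  have h1 : ((p n : ℕ) : ℝ≥0∞) = ENNReal.ofReal (Real.exp (Real.log (p n))) := by
    rw [Real.exp_log hp0, ENNReal.ofReal_natCast]
  rw [h1, hC, ← ENNReal.ofReal_pow (Real.exp_pos _).le, ← ENNReal.ofReal_pow (Real.exp_pos _).le,
    ← Real.exp_nat_mul, ← Real.exp_nat_mul, ← ENNReal.ofReal_mul (Real.exp_pos _).le,
    ← Real.exp_add, ← ENNReal.ofReal_mul (Real.exp_pos _).le, ← Real.exp_add]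
  congr 2
  push_cast
  ring

end Asymptotic

/-! ### Moments of sub-Gaussian variables -/

section Moments

variable {Ω : Type*} [MeasurableSpace Ω] {P : Measure Ω}

/-- One term of the exponential series, with `6! = 720`. A bound on the sixth moment covers both the
third absolute moments (central limit theorem) and the fourth moments (law of large numbers for
squares). -/
lemma pow_six_le_exp (x : ℝ) : x ^ 6 ≤ 720 * (Real.exp x + Real.exp (-x)) := by
  have h := Real.pow_div_factorial_le_exp |x| (abs_nonneg x) 6
  have h1 : |x| ^ 6 = x ^ 6 := Even.pow_abs ⟨3, rfl⟩ x
  have h2 : ((Nat.factorial 6 : ℕ) : ℝ) = 720 := by norm_num [Nat.factorial]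
  have h3 : Real.exp |x| ≤ Real.exp x + Real.exp (-x) := by
    rcases abs_cases x with ⟨h, _⟩ | ⟨h, _⟩ <;> rw [h] <;>
      linarith [Real.exp_pos x, Real.exp_pos (-x)]
  rw [h1, h2, div_le_iff₀ (by norm_num)] at h
  linarith

lemma integrable_pow_six {X : Ω → ℝ} {c : ℝ≥0} (hX : HasSubgaussianMGF X c P) :
    Integrable (fun ω => X ω ^ 6) P := by
  have h := (hX.memLp 6).integrable_norm_pow (by norm_num)
  refine h.congr (ae_of_all _ fun ω => ?_)
  simpa using Even.pow_abs ⟨3, rfl⟩ (X ω)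

lemma integral_pow_six_le {X : Ω → ℝ} {c : ℝ≥0} (hX : HasSubgaussianMGF X c P) :
    ∫ ω, X ω ^ 6 ∂P ≤ 1440 * Real.exp (c / 2) := by
  have h1 := hX.mgf_le 1
  have h2 := hX.mgf_le (-1)
  have i1 := hX.integrable_exp_mul 1
  have i2 := hX.integrable_exp_mul (-1)
  simp only [mgf, one_mul, neg_one_mul, one_pow, mul_one, even_two, Even.neg_pow]
    at h1 h2 i1 i2
  calc ∫ ω, X ω ^ 6 ∂P ≤ ∫ ω, 720 * (Real.exp (X ω) + Real.exp (-X ω)) ∂P :=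
        integral_mono (integrable_pow_six hX) ((i1.add i2).const_mul _)
          fun ω => pow_six_le_exp (X ω)
    _ ≤ 1440 * Real.exp (c / 2) := by
        rw [integral_const_mul, integral_add i1 i2]
        linarith

end Moments

/-! ### Estimates for characteristic functions -/

section Charfun

/-- For `|x| ≤ 1` this is the series remainder, with `e ≤ 4`; for `|x| ≥ 1` the triangle inequality
gives `2 + |x| + |x|²/2`, each power being at most `|x|³`. -/
lemma norm_cexp_taylor_two_le (x : ℝ) :
    ‖Complex.exp (x * Complex.I) - (1 + x * Complex.I - x ^ 2 / 2)‖ ≤ 4 * |x| ^ 3 := by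
  have hn : ‖(x : ℂ) * Complex.I‖ = |x| := by simp
  rcases le_total |x| 1 with hx | hx
  · have h := Complex.norm_exp_sub_sum_le_norm_mul_exp (x * Complex.I) 3
    have h1 : ∑ m ∈ Finset.range 3, ((x : ℂ) * Complex.I) ^ m / (m.factorial : ℂ) =
        1 + x * Complex.I - x ^ 2 / 2 := by
      simp [Finset.sum_range_succ, mul_pow, Nat.factorial]
      ring
    rw [h1, hn] at h
    refine h.trans ?_
    have h2 : Real.exp |x| ≤ 4 :=
      (Real.exp_le_exp.2 hx).trans (by linarith [Real.exp_one_lt_d9])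
    nlinarith [pow_nonneg (abs_nonneg x) 3]
  · have h1 : ‖Complex.exp (x * Complex.I)‖ = 1 := Complex.norm_exp_ofReal_mul_I x
    have h2 : ‖1 + (x : ℂ) * Complex.I - x ^ 2 / 2‖ ≤ 1 + |x| + |x| ^ 2 / 2 := by
      refine (norm_sub_le _ _).trans (add_le_add ((norm_add_le _ _).trans ?_) ?_)
      · rw [hn, norm_one]
      · simp
    refine (norm_sub_le _ _).trans ?_
    rw [h1]
    have h3 : |x| ≤ |x| ^ 3 := le_self_pow₀ hx (by norm_num)
    have h4 : |x| ^ 2 ≤ |x| ^ 3 := pow_le_pow_right₀ hx (by norm_num)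
    linarith

variable {Ω : Type*} [MeasurableSpace Ω] {P : Measure Ω} [IsProbabilityMeasure P]

lemma norm_charFun_sub_le {X : Ω → ℝ} (hX : Measurable X) {v M : ℝ}
    (hX3 : Integrable (fun ω => |X ω| ^ 3) P) (hX2 : Integrable (fun ω => X ω ^ 2) P)
    (hX1 : Integrable X P) (h0 : ∫ ω, X ω ∂P = 0)
    (hv : ∫ ω, X ω ^ 2 ∂P = v) (hM : ∫ ω, |X ω| ^ 3 ∂P ≤ M) (t : ℝ) :
    ‖charFun (P.map X) t - (1 - (v : ℂ) * (t : ℂ) ^ 2 / 2)‖ ≤ 4 * M * |t| ^ 3 := by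
  have hc1 : Integrable (fun ω => ((t * X ω : ℝ) : ℂ) * Complex.I) P :=
    ((hX1.const_mul t).ofReal).mul_const _
  have hc2 : Integrable (fun ω => ((t * X ω : ℝ) : ℂ) ^ 2 / 2) P := by
    have : Integrable (fun ω => (((t ^ 2 * X ω ^ 2 : ℝ)) : ℂ) / 2) P :=
      ((hX2.const_mul (t ^ 2)).ofReal).div_const _
    refine this.congr (ae_of_all _ fun ω => ?_)
    push_cast
    ring
  have hce : Integrable (fun ω => Complex.exp ((t * X ω : ℝ) * Complex.I)) P := by
    refine Integrable.of_bound (by fun_prop) 1 (ae_of_all _ fun ω => ?_)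
    rw [Complex.norm_exp_ofReal_mul_I]
  have hc3 : Integrable (fun ω => 1 + ((t * X ω : ℝ) : ℂ) * Complex.I) P :=
    (integrable_const _).add hc1
  have hc4 : Integrable (fun ω => 1 + ((t * X ω : ℝ) : ℂ) * Complex.I -
      ((t * X ω : ℝ) : ℂ) ^ 2 / 2) P := hc3.sub hc2
  have hchar : charFun (P.map X) t = ∫ ω, Complex.exp ((t * X ω : ℝ) * Complex.I) ∂P := by
    rw [charFun_apply_real, integral_map hX.aemeasurable (by fun_prop)]
    simp
  have hT : ∫ ω, (1 + ((t * X ω : ℝ) : ℂ) * Complex.I - ((t * X ω : ℝ) : ℂ) ^ 2 / 2) ∂P =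
      1 - (v : ℂ) * (t : ℂ) ^ 2 / 2 := by
    rw [integral_sub hc3 hc2, integral_add (integrable_const _) hc1,
      integral_mul_const, integral_complex_ofReal, integral_const_mul, h0]
    have : ∫ ω, ((t * X ω : ℝ) : ℂ) ^ 2 / 2 ∂P = (v : ℂ) * (t : ℂ) ^ 2 / 2 := by
      have h1 : ∀ ω, ((t * X ω : ℝ) : ℂ) ^ 2 / 2 = ((t ^ 2 / 2 * X ω ^ 2 : ℝ) : ℂ) := by
        intro ω; push_cast; ring
      simp_rw [h1]
      rw [integral_complex_ofReal, integral_const_mul, hv]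
      push_cast
      ring
    rw [this]
    simp
  rw [hchar, ← hT, ← integral_sub hce hc4]
  refine (norm_integral_le_integral_norm _).trans ?_
  calc ∫ ω, ‖Complex.exp ((t * X ω : ℝ) * Complex.I) -
        (1 + ((t * X ω : ℝ) : ℂ) * Complex.I - ((t * X ω : ℝ) : ℂ) ^ 2 / 2)‖ ∂P
      ≤ ∫ ω, 4 * |t| ^ 3 * |X ω| ^ 3 ∂P := by
        refine integral_mono (hce.sub hc4).norm
          (hX3.const_mul _) fun ω => ?_
        refine (norm_cexp_taylor_two_le (t * X ω)).trans (le_of_eq ?_)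
        rw [abs_mul]
        ring
    _ ≤ 4 * M * |t| ^ 3 := by
        rw [integral_const_mul]
        have : 0 ≤ 4 * |t| ^ 3 := by positivity
        nlinarith

/-- Quantitative Slutsky: the two exponentials differ by at most `|t| κ` where the variables are
`κ`-close, and by at most `2` elsewhere. -/
lemma norm_charFun_sub_charFun_le {X Y : Ω → ℝ} (hX : Measurable X) (hY : Measurable Y)
    (t : ℝ) {κ : ℝ} (hκ : 0 ≤ κ) :
    ‖charFun (P.map X) t - charFun (P.map Y) t‖ ≤
      |t| * κ + 2 * (P {ω | κ < |X ω - Y ω|}).toReal := by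
  have hce : ∀ {Z : Ω → ℝ}, Measurable Z →
      Integrable (fun ω => Complex.exp ((t * Z ω : ℝ) * Complex.I)) P := by
    intro Z hZ
    refine Integrable.of_bound (by fun_prop) 1 (ae_of_all _ fun ω => ?_)
    rw [Complex.norm_exp_ofReal_mul_I]
  have hchar : ∀ {Z : Ω → ℝ}, Measurable Z →
      charFun (P.map Z) t = ∫ ω, Complex.exp ((t * Z ω : ℝ) * Complex.I) ∂P := by
    intro Z hZ
    rw [charFun_apply_real, integral_map hZ.aemeasurable (by fun_prop)]
    simp
  set S := {ω | κ < |X ω - Y ω|}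
  have hS : MeasurableSet S := measurableSet_lt measurable_const (hX.sub hY).abs
  rw [hchar hX, hchar hY, ← integral_sub (hce hX) (hce hY)]
  refine (norm_integral_le_integral_norm _).trans ?_
  calc ∫ ω, ‖Complex.exp ((t * X ω : ℝ) * Complex.I) -
        Complex.exp ((t * Y ω : ℝ) * Complex.I)‖ ∂P
      ≤ ∫ ω, (|t| * κ + S.indicator (fun _ => 2) ω) ∂P := by
        refine integral_mono ((hce hX).sub (hce hY)).norm ((integrable_const _).add
          ((integrable_const _).indicator hS)) fun ω => ?_
        by_cases hω : ω ∈ S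
        · simp only [hω, Set.indicator_of_mem]
          refine (norm_sub_le _ _).trans ?_
          rw [Complex.norm_exp_ofReal_mul_I, Complex.norm_exp_ofReal_mul_I]
          have : 0 ≤ |t| * κ := by positivity
          linarith
        · simp only [hω, not_false_eq_true, Set.indicator_of_notMem, add_zero]
          have h1 : Complex.exp ((t * X ω : ℝ) * Complex.I) -
              Complex.exp ((t * Y ω : ℝ) * Complex.I) =
              Complex.exp ((t * Y ω : ℝ) * Complex.I) *
                (Complex.exp (Complex.I * (t * (X ω - Y ω) : ℝ)) - 1) := by
            rw [mul_sub, ← Complex.exp_add, mul_one]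
            congr 2
            push_cast
            ring
          rw [h1, norm_mul, Complex.norm_exp_ofReal_mul_I, one_mul]
          refine Real.norm_exp_I_mul_ofReal_sub_one_le.trans ?_
          rw [Real.norm_eq_abs, abs_mul]
          have : |X ω - Y ω| ≤ κ := not_lt.1 hω
          gcongr
    _ = |t| * κ + 2 * (P S).toReal := by
        rw [integral_add (integrable_const _) ((integrable_const _).indicator hS),
          integral_indicator hS]
        simp [Measure.real, mul_comm]

end Charfun

/-! ### Limit theorems for arrays with independent rows -/

section Arrays

lemma indepFun_of_iIndepFun_sum {Ω ι : Type*} [MeasurableSpace Ω] {P : Measure Ω} [Fintype ι]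
    {X Y : ι → Ω → ℝ} (hX : ∀ i, Measurable (X i)) (hY : ∀ i, Measurable (Y i))
    (h : iIndepFun (fun (k : ι ⊕ ι) ω => Sum.elim (fun i => X i ω) (fun i => Y i ω) k) P) :
    IndepFun (fun ω i => X i ω) (fun ω i => Y i ω) P := by
  classical
  have hm : ∀ k : ι ⊕ ι, Measurable fun ω => Sum.elim (fun i => X i ω) (fun i => Y i ω) k := by
    rintro (i | i)
    · exact hX i
    · exact hY i
  have hdisj : Disjoint (Finset.univ.map (Function.Embedding.inl : ι ↪ ι ⊕ ι))
      (Finset.univ.map (Function.Embedding.inr : ι ↪ ι ⊕ ι)) := by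
    rw [Finset.disjoint_left]
    simp
  have := h.indepFun_finset _ _ hdisj hm
  exact this.comp
    (φ := fun x i => x ⟨Sum.inl i, by simp⟩) (ψ := fun x i => x ⟨Sum.inr i, by simp⟩)
    (measurable_pi_lambda _ fun i => measurable_pi_apply _)
    (measurable_pi_lambda _ fun i => measurable_pi_apply _)

lemma iIndepFun_mul_of_iIndepFun_sum {Ω ι : Type*} [MeasurableSpace Ω] {P : Measure Ω}
    [IsProbabilityMeasure P] [Fintype ι]
    {X Y : ι → Ω → ℝ} (hX : ∀ i, Measurable (X i)) (hY : ∀ i, Measurable (Y i))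
    (h : iIndepFun (fun (k : ι ⊕ ι) ω => Sum.elim (fun i => X i ω) (fun i => Y i ω) k) P) :
    iIndepFun (fun i ω => X i ω * Y i ω) P := by
  have hXi : iIndepFun X P := h.precomp (g := Sum.inl) Sum.inl_injective
  have hYi : iIndepFun Y P := h.precomp (g := Sum.inr) Sum.inr_injective
  have hXY := indepFun_of_iIndepFun_sum hX hY h
  have hXYi : ∀ i, IndepFun (X i) (Y i) P := fun i =>
    hXY.comp (measurable_pi_apply i) (measurable_pi_apply i)
  have hmX : Measurable fun ω i => X i ω := measurable_pi_lambda _ hX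
  have hmY : Measurable fun ω i => Y i ω := measurable_pi_lambda _ hY
  have hpair : iIndepFun (fun i ω => (X i ω, Y i ω)) P := by
    rw [iIndepFun_iff_map_fun_eq_pi_map fun i => ((hX i).prodMk (hY i)).aemeasurable]
    have h1 : ∀ i, P.map (fun ω => (X i ω, Y i ω)) = (P.map (X i)).prod (P.map (Y i)) := fun i =>
      (indepFun_iff_map_prod_eq_prod_map_map (hX i).aemeasurable (hY i).aemeasurable).1 (hXYi i)
    have h2 := (indepFun_iff_map_prod_eq_prod_map_map hmX.aemeasurable hmY.aemeasurable).1 hXY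
    rw [(iIndepFun_iff_map_fun_eq_pi_map fun i => (hX i).aemeasurable).1 hXi,
      (iIndepFun_iff_map_fun_eq_pi_map fun i => (hY i).aemeasurable).1 hYi] at h2
    simp_rw [h1]
    have := fun i => Measure.isProbabilityMeasure_map (μ := P) (hX i).aemeasurable
    have := fun i => Measure.isProbabilityMeasure_map (μ := P) (hY i).aemeasurable
    -- The joint law of the two vectors is a product of two product measures; regrouping coordinates
    -- turns it into the product over `i` of the laws of the pairs.
    have h3 := (measurePreserving_arrowProdEquivProdArrow ℝ ℝ ι
      (fun i => P.map (X i)) (fun i => P.map (Y i))).symm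
    rw [← h3.map_eq, ← h2, Measure.map_map (MeasurableEquiv.measurable _) (hmX.prodMk hmY)]
    rfl
  exact hpair.comp (fun _ x => x.1 * x.2) fun _ => measurable_fst.mul measurable_snd

variable {Ω : ℕ → Type*} [∀ n, MeasurableSpace (Ω n)] {P : ∀ n, Measure (Ω n)}
  [∀ n, IsProbabilityMeasure (P n)]

lemma tendsto_natCast_sqrt_atTop : Tendsto (fun n : ℕ => √(n : ℝ)) atTop atTop :=
  Real.tendsto_sqrt_atTop.comp tendsto_natCast_atTop_atTop

/-- The weak law of large numbers, with a rate, for arrays with independent rows. -/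
lemma isLittleOInProb_sum_sub {X : ∀ n, Fin n → Ω n → ℝ} (hX : ∀ n i, MemLp (X n i) 2 (P n))
    (hind : ∀ n, iIndepFun (X n) (P n)) {e M : ℝ} (he : ∀ n i, ∫ ω, X n i ω ∂(P n) = e)
    (hM : ∀ n i, Var[X n i; P n] ≤ M) :
    IsLittleOInProb P (fun n ω => ∑ i, X n i ω - n * e) (fun n => √(n : ℝ) * √√(n : ℝ)) := by
  intro κ hκ
  have hlim : Tendsto (fun n : ℕ => ENNReal.ofReal (M / κ ^ 2 * (√(n : ℝ))⁻¹)) atTop (𝓝 0) := by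
    rw [← ENNReal.ofReal_zero]
    refine (ENNReal.continuous_ofReal.tendsto 0).comp ?_
    simpa using (tendsto_natCast_sqrt_atTop.inv_tendsto_atTop).const_mul (M / κ ^ 2)
  refine tendsto_of_tendsto_of_tendsto_of_le_of_le' tendsto_const_nhds hlim
    (Eventually.of_forall fun _ => zero_le) ?_
  filter_upwards [eventually_ge_atTop 1] with n hn
  have hn0 : (0 : ℝ) < n := by exact_mod_cast hn
  have hint : ∫ ω, (∑ i, X n i) ω ∂(P n) = n * e := by
    simp only [Finset.sum_apply]
    rw [integral_finsetSum _ fun i _ => (hX n i).integrable (by norm_num)]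
    simp [he]
  have hvar : Var[∑ i, X n i; P n] ≤ n * M := by
    rw [IndepFun.variance_sum (fun i _ => hX n i)
      fun i _ j _ hij => (hind n).indepFun hij]
    refine (Finset.sum_le_sum fun i _ => hM n i).trans (by simp)
  have hmem : MemLp (∑ i, X n i) 2 (P n) := memLp_finsetSum' _ fun i _ => hX n i
  -- Chebyshev at radius `κ n^(3/4)` gives `nM / (κ² n^(3/2))`, of order `n^(-1/2)`.
  have hr : 0 < κ * (√(n : ℝ) * √√(n : ℝ)) := by positivity
  have hcheb := meas_ge_le_variance_div_sq hmem hr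
  rw [hint] at hcheb
  refine (measure_mono fun ω hω => ?_).trans (hcheb.trans (ENNReal.ofReal_le_ofReal ?_))
  · have hω' : κ * (√(n : ℝ) * √√(n : ℝ)) < |∑ i, X n i ω - n * e| := hω
    simpa using hω'.le
  · have hsq : √(n : ℝ) * √(n : ℝ) = n := Real.mul_self_sqrt hn0.le
    have hsq2 : √√(n : ℝ) ^ 2 = √(n : ℝ) := Real.sq_sqrt (Real.sqrt_nonneg _)
    have hs0 : 0 < √(n : ℝ) := Real.sqrt_pos.2 hn0
    rw [mul_pow, mul_pow, hsq2, pow_two (√(n : ℝ)), hsq]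
    calc _ ≤ (n * M) / (κ ^ 2 * (n * √(n : ℝ))) := by gcongr
      _ = _ := by field_simp

/-- The central limit theorem for arrays with i.i.d. rows and bounded third moments. -/
lemma tendsto_charFun_row_sum {X : ∀ n, Fin n → Ω n → ℝ} (hX : ∀ n i, Measurable (X n i))
    (hind : ∀ n, iIndepFun (X n) (P n))
    (hid : ∀ n i j, IdentDistrib (X n i) (X n j) (P n) (P n))
    {v M : ℝ} (hX3 : ∀ n i, Integrable (fun ω => |X n i ω| ^ 3) (P n))
    (h2 : ∀ n i, MemLp (X n i) 2 (P n)) (h0 : ∀ n i, ∫ ω, X n i ω ∂(P n) = 0)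
    (hv : ∀ n i, ∫ ω, X n i ω ^ 2 ∂(P n) = v)
    (hM : ∀ n i, ∫ ω, |X n i ω| ^ 3 ∂(P n) ≤ M) (t : ℝ) :
    Tendsto (fun n : ℕ => charFun ((P n).map fun ω => (√(n : ℝ))⁻¹ * ∑ i, X n i ω) t) atTop
      (𝓝 (Complex.exp (-(v * t ^ 2 / 2 : ℝ)))) := by
  -- the common characteristic function of the entries in the row `n`
  let φ : ℕ → ℂ := fun n => if h : 0 < n then
    charFun ((P n).map (X n ⟨0, h⟩)) ((√(n : ℝ))⁻¹ * t) else 1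
  have hpow : ∀ n, charFun ((P n).map fun ω => (√(n : ℝ))⁻¹ * ∑ i, X n i ω) t = φ n ^ n := by
    intro n
    rw [charFun_map_mul_comp (Finset.aemeasurable_fun_sum _ fun i _ => (hX n i).aemeasurable),
      (hind n).charFun_map_fun_sum_eq_prod fun i => (hX n i).aemeasurable, Finset.prod_apply]
    rcases Nat.eq_zero_or_pos n with rfl | hn
    · simp
    · simp only [φ, hn, dif_pos]
      rw [Finset.prod_congr rfl fun i _ => by rw [(hid n i ⟨0, hn⟩).map_eq]]
      simp
  simp_rw [hpow]
  -- It suffices that `φ n = 1 - v t² / (2n) + o(1/n)`; the cubic remainder at `t / √n` is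
  -- `O(n^(-3/2))`.
  apply Complex.tendsto_pow_exp_of_isLittleO_sub_add_div
  rw [isLittleO_iff]
  intro c hc
  have hlim : Tendsto (fun n : ℕ => 4 * M * |t| ^ 3 * (√(n : ℝ))⁻¹) atTop (𝓝 0) := by
    simpa using (tendsto_natCast_sqrt_atTop.inv_tendsto_atTop).const_mul (4 * M * |t| ^ 3)
  filter_upwards [eventually_ge_atTop 1, hlim.eventually_le_const hc] with n hn hnc
  have hn' : 0 < n := hn
  have hn0 : (0 : ℝ) < n := by exact_mod_cast hn
  have hs0 : 0 < √(n : ℝ) := Real.sqrt_pos.2 hn0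
  have hsq : √(n : ℝ) ^ 2 = n := Real.sq_sqrt hn0.le
  simp only [φ, hn', dif_pos]
  have hb := norm_charFun_sub_le (hX n ⟨0, hn'⟩) (hX3 n _) (h2 n _).integrable_sq
    ((h2 n _).integrable (by norm_num)) (h0 n _) (hv n _) (hM n _) ((√(n : ℝ))⁻¹ * t)
  have he : (1 : ℂ) + (-(v * t ^ 2 / 2 : ℝ) : ℂ) / n =
      1 - (v : ℂ) * (((√(n : ℝ))⁻¹ * t : ℝ) : ℂ) ^ 2 / 2 := by
    have : (((√(n : ℝ))⁻¹ * t : ℝ) : ℂ) ^ 2 = t ^ 2 / n := by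
      have h1 : ((√(n : ℝ))⁻¹ * t) ^ 2 = t ^ 2 / n := by
        rw [mul_pow, inv_pow, hsq]; field_simp
      exact_mod_cast congrArg (fun x : ℝ => (x : ℂ)) h1
    rw [this]
    push_cast
    ring
  rw [he]
  refine hb.trans ?_
  have h3 : 4 * M * |(√(n : ℝ))⁻¹ * t| ^ 3 = 4 * M * |t| ^ 3 * (√(n : ℝ))⁻¹ * (1 / n) := by
    have h5 : (1 : ℝ) / n = (√(n : ℝ))⁻¹ ^ 2 := by rw [inv_pow, hsq, one_div]
    rw [abs_mul, abs_of_pos (inv_pos.2 hs0), h5]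
    ring
  rw [h3]
  have h4 : ‖(1 : ℂ) / n‖ = 1 / n := by simp
  rw [h4]
  gcongr

/-- Slutsky's lemma along a sequence of probability spaces. -/
lemma tendstoInDistribution_of_charFun_of_sub {S T : ∀ n, Ω n → ℝ} (hS : ∀ n, Measurable (S n))
    (hT : ∀ n, Measurable (T n)) (hsub : IsLittleOInProb P (fun n ω => T n ω - S n ω) 1)
    {Q : Measure ℝ} [IsProbabilityMeasure Q]
    (hlim : ∀ t, Tendsto (fun n => charFun ((P n).map (S n)) t) atTop (𝓝 (charFun Q t))) :
    TendstoInDistribution T atTop (id : ℝ → ℝ) P Q := by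
  refine ⟨fun n => (hT n).aemeasurable, aemeasurable_id, ?_⟩
  refine ProbabilityMeasure.tendsto_iff_tendsto_charFun.2 fun t => ?_
  change Tendsto (fun n => charFun ((P n).map (T n)) t) atTop (𝓝 (charFun (Q.map id) t))
  rw [Measure.map_id]
  have hdiff : Tendsto (fun n => charFun ((P n).map (T n)) t - charFun ((P n).map (S n)) t)
      atTop (𝓝 0) := by
    rw [Metric.tendsto_nhds]
    intro r hr
    -- Makes `|t| κ < r/2`, also at `t = 0`; the probability term takes the other half.
    set κ := r / (2 * (|t| + 1))
    have hκ : 0 < κ := by positivity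
    have htκ : |t| * κ < r / 2 := by
      have : κ * (|t| + 1) = r / 2 := by simp only [κ]; field_simp
      nlinarith
    have h1 : Tendsto (fun n => (P n {ω | κ < |T n ω - S n ω|}).toReal) atTop (𝓝 0) := by
      have := (ENNReal.tendsto_toReal ENNReal.zero_ne_top).comp (hsub κ hκ)
      simpa [Function.comp_def] using this
    filter_upwards [h1.eventually_lt_const (by positivity : 0 < r / 4)] with n hn
    rw [dist_zero_right]
    refine (norm_charFun_sub_charFun_le (hT n) (hS n) t hκ.le).trans_lt ?_
    linarith
  simpa using hdiff.add (hlim t)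

end Arrays

/-! ### Fisher information of the submodels and the information bound -/

section Information

variable {n : ℕ}

lemma submodelScore_eq {σ : ℝ≥0} (hσ : 0 < σ) (β : ℝ) (x g h y : EuclideanSpace ℝ (Fin n)) :
    submodelScore σ β x g h y = inner ℝ (y - (β • x + g)) (x + h) / σ ^ 2 := by
  have hσ0 : (σ : ℝ) ≠ 0 := by exact_mod_cast hσ.ne'
  have hc : (√(2 * Real.pi * ((σ ^ 2 : ℝ≥0) : ℝ)))⁻¹ ≠ 0 := by
    have : 0 < (σ : ℝ) := by exact_mod_cast hσ
    push_cast
    positivity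
  have hlog : ∀ m z : ℝ, Real.log (gaussianPDFReal m (σ ^ 2) z) =
      Real.log (√(2 * Real.pi * ((σ ^ 2 : ℝ≥0) : ℝ)))⁻¹ + -(z - m) ^ 2 / (2 * (σ : ℝ) ^ 2) := by
    intro m z
    rw [gaussianPDFReal, Real.log_mul hc (Real.exp_pos _).ne', Real.log_exp]
    simp
  unfold submodelScore gaussianLogLik
  simp_rw [hlog]
  have hd : ∀ i, HasDerivAt (fun t : ℝ => Real.log (√(2 * Real.pi * ((σ ^ 2 : ℝ≥0) : ℝ)))⁻¹ +
      -(y i - ((β + t) • x + (g + t • h)) i) ^ 2 / (2 * (σ : ℝ) ^ 2))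
      ((y i - (β * x i + g i)) * (x i + h i) / σ ^ 2) 0 := by
    intro i
    have h1 : HasDerivAt (fun t : ℝ => y i - ((β + t) * x i + (g i + t * h i)))
        (-(1 * x i + 1 * h i)) 0 :=
      ((((hasDerivAt_id (0 : ℝ)).const_add β).mul_const (x i)).add
        (((hasDerivAt_id (0 : ℝ)).mul_const (h i)).const_add (g i))).const_sub (y i)
    have h2 := (((h1.pow 2).neg).div_const (2 * (σ : ℝ) ^ 2)).const_add
      (Real.log (√(2 * Real.pi * ((σ ^ 2 : ℝ≥0) : ℝ)))⁻¹)
    refine (h2.congr_deriv ?_).congr_of_eventuallyEq (Eventually.of_forall fun t => ?_)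
    · simp
      field_simp
      ring
    · simp
  rw [(HasDerivAt.fun_sum fun i _ => hd i).deriv, ← Finset.sum_div]
  congr 1
  simp [PiLp.inner_apply, mul_comm]

variable {Ω : Type*} [MeasurableSpace Ω] {P : Measure Ω} [IsProbabilityMeasure P]

lemma lintegral_comp_of_indepFun {A B : Type*} [MeasurableSpace A] [MeasurableSpace B]
    {a : Ω → A} {b : Ω → B} (ha : Measurable a) (hb : Measurable b) (hab : IndepFun a b P)
    {F : A × B → ℝ≥0∞} (hF : Measurable F) :
    ∫⁻ ω, F (a ω, b ω) ∂P = ∫⁻ ω', ∫⁻ ω, F (a ω', b ω) ∂P ∂P := by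
  have := Measure.isProbabilityMeasure_map (μ := P) ha.aemeasurable
  have := Measure.isProbabilityMeasure_map (μ := P) hb.aemeasurable
  rw [← lintegral_map (f := F) hF (ha.prodMk hb),
    (indepFun_iff_map_prod_eq_prod_map_map ha.aemeasurable hb.aemeasurable).1 hab,
    lintegral_prod _ hF.aemeasurable, lintegral_map hF.lintegral_prod_right' ha]
  refine lintegral_congr fun ω' => ?_
  exact lintegral_map (hF.comp measurable_prodMk_left) hb

lemma lintegral_inner_sq {ε : Ω → EuclideanSpace ℝ (Fin n)} {σ : ℝ}
    (hL2 : ∀ i, MemLp (fun ω => ε ω i) 2 P) (hind : iIndepFun (fun i ω => ε ω i) P)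
    (h0 : ∀ i, ∫ ω, ε ω i ∂P = 0) (hvar : ∀ i, Var[fun ω => ε ω i; P] = σ ^ 2)
    (v : EuclideanSpace ℝ (Fin n)) :
    ∫⁻ ω, ENNReal.ofReal (inner ℝ (ε ω) v ^ 2) ∂P = ENNReal.ofReal (σ ^ 2 * ‖v‖ ^ 2) := by
  have hLv : ∀ i, MemLp (fun ω => v i * ε ω i) 2 P := fun i => (hL2 i).const_mul (v i)
  have hsum : (fun ω => inner ℝ (ε ω) v) = ∑ i, fun ω => v i * ε ω i := by
    ext ω
    simp [PiLp.inner_apply]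
  have hmem : MemLp (fun ω => inner ℝ (ε ω) v) 2 P := by
    rw [hsum]
    exact memLp_finsetSum' _ fun i _ => hLv i
  have hmean : ∫ ω, inner ℝ (ε ω) v ∂P = 0 := by
    have h1 : ∀ ω, inner ℝ (ε ω) v = ∑ i, v i * ε ω i := fun ω => by
      simp [PiLp.inner_apply]
    simp_rw [h1]
    rw [integral_finsetSum _ fun i _ => (hLv i).integrable (by norm_num)]
    simp [integral_const_mul, h0]
  rw [← ofReal_integral_eq_lintegral_ofReal hmem.integrable_sq (ae_of_all _ fun _ => sq_nonneg _),
    ← variance_of_integral_eq_zero hmem.aestronglyMeasurable.aemeasurable hmean, hsum,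
    IndepFun.variance_sum (fun i _ => hLv i)]
  · congr 1
    simp_rw [variance_const_mul, hvar]
    rw [EuclideanSpace.norm_sq_eq, Finset.mul_sum]
    simp [mul_comm]
  · intro i _ j _ hij
    exact (hind.indepFun hij).comp (measurable_const_mul (v i)) (measurable_const_mul (v j))

lemma lintegral_norm_add_sq {η : Ω → EuclideanSpace ℝ (Fin n)} {σ : ℝ}
    (hL2 : ∀ i, MemLp (fun ω => η ω i) 2 P)
    (h0 : ∀ i, ∫ ω, η ω i ∂P = 0) (hvar : ∀ i, Var[fun ω => η ω i; P] = σ ^ 2)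
    (a : EuclideanSpace ℝ (Fin n)) :
    ∫⁻ ω, ENNReal.ofReal (‖a + η ω‖ ^ 2) ∂P = ENNReal.ofReal (‖a‖ ^ 2 + n * σ ^ 2) := by
  have hi : ∀ i, MemLp (fun ω => a i + η ω i) 2 P := fun i => (memLp_const (a i)).add (hL2 i)
  have hnorm : ∀ ω, ‖a + η ω‖ ^ 2 = ∑ i, (a i + η ω i) ^ 2 := by
    intro ω
    rw [EuclideanSpace.norm_sq_eq]
    simp
  have hcoord : ∀ i, ∫ ω, (a i + η ω i) ^ 2 ∂P = a i ^ 2 + σ ^ 2 := by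
    intro i
    have h1 := variance_eq_sub (hi i)
    have h2 : ∫ ω, (a i + η ω i) ∂P = a i := by
      rw [integral_add (integrable_const _) ((hL2 i).integrable (by norm_num)), h0]
      simp
    rw [h2, variance_const_add (hL2 i).aestronglyMeasurable, hvar] at h1
    simp only [Pi.pow_apply] at h1
    linarith
  simp_rw [hnorm]
  rw [← ofReal_integral_eq_lintegral_ofReal (integrable_finsetSum _ fun i _ => (hi i).integrable_sq)
    (ae_of_all _ fun _ => Finset.sum_nonneg fun _ _ => sq_nonneg _),
    integral_finsetSum _ fun i _ => (hi i).integrable_sq]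
  simp_rw [hcoord]
  rw [Finset.sum_add_distrib, EuclideanSpace.norm_sq_eq]
  simp

variable {𝓦 : Type*} [MeasurableSpace 𝓦]

/-- The score is `⟪ε, ν + h + η⟫ / σ_ε²`. Integrate out `ε`, then `η`, with `W` fixed: the first
gives `σ_ε² ‖ν + h + η‖²`, and the second removes the cross term. -/
lemma submodelInfo_eq {σε ση : ℝ≥0} (hσε : 0 < σε) {β : ℝ} {W : Ω → 𝓦}
    {X Y μ ν η ε : Ω → EuclideanSpace ℝ (Fin n)} (hW : Measurable W)
    (hηm : Measurable η) (hεm : Measurable ε)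
    (hY : ∀ ω, Y ω = β • X ω + μ ω + ε ω) (hX : ∀ ω, X ω = ν ω + η ω)
    (hηε : IndepFun η ε P) (hindW : IndepFun W (fun ω => (η ω, ε ω)) P)
    (hε : iIndepFun (fun i ω => ε ω i) P)
    (hηL2 : ∀ i, MemLp (fun ω => η ω i) 2 P) (hεL2 : ∀ i, MemLp (fun ω => ε ω i) 2 P)
    (hη0 : ∀ i, ∫ ω, η ω i ∂P = 0) (hε0 : ∀ i, ∫ ω, ε ω i ∂P = 0)
    (hηvar : ∀ i, Var[fun ω => η ω i; P] = (ση : ℝ) ^ 2)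
    (hεvar : ∀ i, Var[fun ω => ε ω i; P] = (σε : ℝ) ^ 2)
    {ν' φ : 𝓦 → EuclideanSpace ℝ (Fin n)} (hν' : Measurable ν') (hν : ∀ ω, ν ω = ν' (W ω))
    (hφ : Measurable φ) :
    submodelInfo P σε β X μ (fun ω => φ (W ω)) Y =
      ∫⁻ ω, ENNReal.ofReal ((‖ν ω + φ (W ω)‖ ^ 2 + n * (ση : ℝ) ^ 2) / (σε : ℝ) ^ 2) ∂P := by
  have hσ0 : (σε : ℝ) ≠ 0 := by exact_mod_cast hσε.ne'
  have hscore : ∀ ω, ENNReal.ofReal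
      (submodelScore σε β (X ω) (μ ω) (φ (W ω)) (Y ω) ^ 2) =
      ENNReal.ofReal ((((σε : ℝ) ^ 2)⁻¹) ^ 2) *
        ENNReal.ofReal (inner ℝ (ε ω) ((ν' (W ω) + φ (W ω)) + η ω) ^ 2) := by
    intro ω
    rw [submodelScore_eq hσε, hY, add_sub_cancel_left, ← ENNReal.ofReal_mul (by positivity), hX,
      hν, add_right_comm, div_eq_inv_mul, mul_pow]
  have hfix : ∀ a : EuclideanSpace ℝ (Fin n),
      ∫⁻ ω, ENNReal.ofReal (inner ℝ (ε ω) (a + η ω) ^ 2) ∂P =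
        ENNReal.ofReal ((σε : ℝ) ^ 2) * ENNReal.ofReal (‖a‖ ^ 2 + n * (ση : ℝ) ^ 2) := by
    intro a
    rw [lintegral_comp_of_indepFun hηm hεm hηε
      (F := fun x => ENNReal.ofReal (inner ℝ x.2 (a + x.1) ^ 2)) (by fun_prop)]
    simp_rw [lintegral_inner_sq hεL2 hε hε0 hεvar]
    simp_rw [ENNReal.ofReal_mul (sq_nonneg (σε : ℝ))]
    rw [lintegral_const_mul _ (by fun_prop), lintegral_norm_add_sq hηL2 hη0 hηvar]
  unfold submodelInfo
  simp_rw [hscore]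
  rw [lintegral_const_mul _ (by fun_prop), lintegral_comp_of_indepFun hW (hηm.prodMk hεm) hindW
    (F := fun x => ENNReal.ofReal (inner ℝ x.2.2 ((ν' x.1 + φ x.1) + x.2.1) ^ 2)) (by fun_prop)]
  simp only [hfix]
  rw [← lintegral_const_mul _ (by fun_prop)]
  refine lintegral_congr fun ω => ?_
  rw [← ENNReal.ofReal_mul (by positivity), ← ENNReal.ofReal_mul (by positivity), hν]
  congr 1
  field_simp

lemma informationBound_eq {σε ση : ℝ≥0} (hσε : 0 < σε) (hση : 0 < ση) (hn : 1 ≤ n) {β : ℝ}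
    {W : Ω → 𝓦} {X Y μ ν η ε : Ω → EuclideanSpace ℝ (Fin n)} (hW : Measurable W)
    (hηm : Measurable η) (hεm : Measurable ε)
    (hY : ∀ ω, Y ω = β • X ω + μ ω + ε ω) (hX : ∀ ω, X ω = ν ω + η ω)
    (hηε : IndepFun η ε P) (hindW : IndepFun W (fun ω => (η ω, ε ω)) P)
    (hε : iIndepFun (fun i ω => ε ω i) P)
    (hηL2 : ∀ i, MemLp (fun ω => η ω i) 2 P) (hεL2 : ∀ i, MemLp (fun ω => ε ω i) 2 P)
    (hη0 : ∀ i, ∫ ω, η ω i ∂P = 0) (hε0 : ∀ i, ∫ ω, ε ω i ∂P = 0)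
    (hηvar : ∀ i, Var[fun ω => η ω i; P] = (ση : ℝ) ^ 2)
    (hεvar : ∀ i, Var[fun ω => ε ω i; P] = (σε : ℝ) ^ 2)
    {ν' : 𝓦 → EuclideanSpace ℝ (Fin n)} (hν' : Measurable ν') (hν : ∀ ω, ν ω = ν' (W ω)) :
    informationBound P σε β W X μ Y = ((σε ^ 2 / ση ^ 2 : ℝ≥0) : ℝ≥0∞) := by
  have hinfo := fun φ hφ => submodelInfo_eq (φ := φ) hσε hW hηm hεm hY hX hηε hindW hε hηL2 hεL2
    hη0 hε0 hηvar hεvar hν' hν hφ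
  have hconst : (n : ℝ≥0∞) / ENNReal.ofReal (n * (ση : ℝ) ^ 2 / (σε : ℝ) ^ 2) =
      ((σε ^ 2 / ση ^ 2 : ℝ≥0) : ℝ≥0∞) := by
    have hσε' : 0 < (σε : ℝ) := by exact_mod_cast hσε
    have hση' : 0 < (ση : ℝ) := by exact_mod_cast hση
    have hn' : 0 < (n : ℝ) := by exact_mod_cast hn
    rw [← ENNReal.ofReal_natCast, ← ENNReal.ofReal_div_of_pos (by positivity),
      ← ENNReal.ofReal_coe_nnreal]
    congr 1
    push_cast
    field_simp
  unfold informationBound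
  rw [← hconst]
  -- The least favourable direction `h = -ν` leaves the score `⟪ε, η⟫ / σ_ε²`. Any other direction
  -- adds the nonnegative `‖ν + h‖²` to the information.
  refine le_antisymm (iSup₂_le fun φ hφ => ?_) (le_iSup₂_of_le (fun w => -ν' w) hν'.neg ?_)
  · refine ENNReal.div_le_div_left ?_ _
    rw [hinfo φ hφ]
    calc ENNReal.ofReal (n * (ση : ℝ) ^ 2 / (σε : ℝ) ^ 2)
        = ∫⁻ _, ENNReal.ofReal (n * (ση : ℝ) ^ 2 / (σε : ℝ) ^ 2) ∂P := by simp
      _ ≤ _ := lintegral_mono fun ω => ENNReal.ofReal_le_ofReal (by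
          gcongr
          exact le_add_of_nonneg_left (sq_nonneg _))
  · rw [hinfo (fun w => -ν' w) hν'.neg]
    simp [hν]

end Information

/-! ### From residual bounds to the error of the ratio -/

section Deviation

/-- The deviation of the residual-on-residual ratio from `β` is `⟪η, ε⟫ / (c q ^ 4)` up to a
remainder of smaller order than `q ^ (-2)`. -/
lemma abs_ratio_sub_le {E : Type*} [NormedAddCommGroup E] [InnerProductSpace ℝ E]
    {η ε dx dy rX rY : E} {β c q δ A : ℝ} (hrX : rX = η + dx) (hrY : rY = β • η + ε + dy)
    (hq : 1 ≤ q) (hc : 0 < c) (hA : 1 ≤ A) (hδ0 : 0 ≤ δ) (hδ1 : δ ≤ 1) (hδc : 8 * A * δ ≤ c)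
    (hηε : |inner ℝ η ε| ≤ δ * q ^ 3) (hη : |‖η‖ ^ 2 - c * q ^ 4| ≤ δ * q ^ 3)
    (hx : ‖dx‖ ^ 2 ≤ A * (δ * q ^ 2)) (hy : ‖dy‖ ^ 2 ≤ A * (δ * q ^ 2))
    (hηx : |inner ℝ η dx| ≤ A * (δ * q ^ 2)) (hηy : |inner ℝ η dy| ≤ A * (δ * q ^ 2))
    (hεx : |inner ℝ ε dx| ≤ A * (δ * q ^ 2)) :
    |q ^ 2 * (inner ℝ rX rY / ‖rX‖ ^ 2 - β) - inner ℝ η ε / (c * q ^ 2)| ≤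
      2 * (4 * A + c * (3 * A * (1 + |β|))) * δ / c ^ 2 := by
  obtain ⟨a, ha⟩ : ∃ a, a = inner ℝ η ε := ⟨_, rfl⟩
  obtain ⟨R, hR⟩ : ∃ R, R = ‖rX‖ ^ 2 := ⟨_, rfl⟩
  obtain ⟨D, hD⟩ : ∃ D, D = A * (δ * q ^ 2) := ⟨_, rfl⟩
  rw [← hD] at hx hy hηx hηy hεx
  -- `B` is everything in `⟪rX, rY⟫` beyond `β ‖rX‖² + ⟪η, ε⟫`; each of its terms is at most a
  -- constant times `D`. In the application `q = n^(1/4)`.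
  obtain ⟨B, hB⟩ : ∃ B, B = inner ℝ η dy - β * inner ℝ η dx + inner ℝ ε dx +
    inner ℝ dx dy - β * ‖dx‖ ^ 2 := ⟨_, rfl⟩
  have hD0 : 0 ≤ D := (sq_nonneg _).trans hx
  have hq0 : 0 < q := by linarith
  have hq23 : q ^ 2 ≤ q ^ 3 := pow_le_pow_right₀ hq (by norm_num)
  have hq34 : q ^ 3 ≤ q ^ 4 := pow_le_pow_right₀ hq (by norm_num)
  have hR' : R = ‖η‖ ^ 2 + 2 * inner ℝ η dx + ‖dx‖ ^ 2 := by
    rw [hR, hrX, norm_add_sq_real]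
  have hnum : inner ℝ rX rY = β * R + a + B := by
    rw [hrY, hR', ha, hB, hrX]
    simp only [inner_add_left, inner_add_right, inner_smul_right, real_inner_self_eq_norm_sq,
      real_inner_comm η dx, real_inner_comm ε dx]
    ring
  have hRc : |R - c * q ^ 4| ≤ 4 * A * δ * q ^ 3 := by
    have h1 : 3 * D ≤ 3 * A * δ * q ^ 3 := by
      rw [hD]
      nlinarith [mul_nonneg (by linarith : 0 ≤ A) hδ0]
    have h2 : δ * q ^ 3 ≤ A * δ * q ^ 3 := by
      nlinarith [mul_nonneg hδ0 (pow_pos hq0 3).le]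
    have h3 := abs_le.1 hη
    have h4 := abs_le.1 hηx
    have h5 := sq_nonneg ‖dx‖
    rw [hR', abs_le]
    constructor <;> linarith
  have hRlow : c / 2 * q ^ 4 ≤ R := by
    have h1 : 4 * A * δ * q ^ 3 ≤ c / 2 * q ^ 4 := by
      calc 4 * A * δ * q ^ 3 ≤ c / 2 * q ^ 3 := by gcongr; linarith
        _ ≤ c / 2 * q ^ 4 := by gcongr
    have := (abs_le.1 hRc).1
    linarith
  have hR0 : 0 < R := lt_of_lt_of_le (by positivity) hRlow
  have hBle : |B| ≤ 3 * (1 + |β|) * D := by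
    have hxy : |inner ℝ dx dy| ≤ D := by
      refine (abs_real_inner_le_norm _ _).trans ?_
      nlinarith [sq_nonneg (‖dx‖ - ‖dy‖)]
    have h1 : |β * inner ℝ η dx| ≤ |β| * D := by rw [abs_mul]; gcongr
    have h2 : |β * ‖dx‖ ^ 2| ≤ |β| * D := by
      rw [abs_mul, abs_of_nonneg (sq_nonneg ‖dx‖)]; gcongr
    have h3 := abs_le.1 h1
    have h4 := abs_le.1 h2
    have h5 := abs_le.1 hxy
    have h6 := abs_le.1 hηy
    have h7 := abs_le.1 hεx
    have h8 : 0 ≤ |β| * D := by positivity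
    rw [hB, abs_le]
    constructor <;> linarith
  have hid : q ^ 2 * (inner ℝ rX rY / R - β) - a / (c * q ^ 2) =
      (a * (c * q ^ 4 - R) + c * q ^ 4 * B) / (R * (c * q ^ 2)) := by
    rw [hnum]
    field_simp
    ring
  -- Two factors of size `δ q³` and the product of `q⁴` with `B ~ δ q²` both yield `q⁶`, matching
  -- the denominator. Here `δ ≤ 1` reduces `δ²` to `δ`.
  have hnumle : |a * (c * q ^ 4 - R) + c * q ^ 4 * B| ≤
      (4 * A + c * (3 * A * (1 + |β|))) * δ * q ^ 6 := by
    refine (abs_add_le _ _).trans ?_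
    rw [abs_mul, abs_mul, abs_sub_comm (c * q ^ 4), abs_of_pos (by positivity : 0 < c * q ^ 4)]
    rw [← ha] at hηε
    calc |a| * |R - c * q ^ 4| + c * q ^ 4 * |B|
        ≤ (δ * q ^ 3) * (4 * A * δ * q ^ 3) + c * q ^ 4 * (3 * (1 + |β|) * D) := by gcongr
      _ = (4 * A * (δ * δ) + c * (3 * A * (1 + |β|)) * δ) * q ^ 6 := by rw [hD]; ring
      _ ≤ (4 * A * (δ * 1) + c * (3 * A * (1 + |β|)) * δ) * q ^ 6 := by gcongr
      _ = _ := by ring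
  rw [← ha, ← hR, hid, abs_div, abs_of_pos (by positivity : 0 < R * (c * q ^ 2))]
  calc _ ≤ (4 * A + c * (3 * A * (1 + |β|))) * δ * q ^ 6 / (c / 2 * q ^ 4 * (c * q ^ 2)) := by
        gcongr
    _ = _ := by field_simp

variable {n p : ℕ}

/-- The regression of `Y` has signal `βν + μ` and noise `βη + ε`. Projections of that noise are
bounded by `2(β² + 1)` times the bound for `η` and `ε`; with the factor `15` of the oracle bounds
this gives `30(β² + 1)`. -/
lemma scaled_error_le {Z : Matrix (Fin n) (Fin p) ℝ} {μ ν η ε : EuclideanSpace ℝ (Fin n)}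
    {β αY αX c q δ : ℝ} {uθ uδ sθ sδ : ℕ} (hαY : 0 < αY) (hαX : 0 < αX) (hq : 1 ≤ q) (hc : 0 < c)
    (hδ0 : 0 ≤ δ) (hδ1 : δ ≤ 1) (hδc : 8 * (30 * (β ^ 2 + 1)) * δ ≤ c)
    (hsθ : sθ ≤ uθ) (huθ : uθ ≤ p) (hsδ : sδ ≤ uδ) (huδ : uδ ≤ p)
    (h1 : supProj uθ Z (β • ν + μ) η ≤ δ * q ^ 2) (h2 : supProj uθ Z (β • ν + μ) ε ≤ δ * q ^ 2)
    (h3 : supProj uδ Z ν η ≤ δ * q ^ 2) (h4 : supProj uδ Z ν ε ≤ δ * q ^ 2)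
    {mθ mδ : Finset (Fin p)} (hmθ : mθ ∈ models p sθ) (hmδ : mδ ∈ models p sδ)
    (h5 : residualSq Z mθ (β • ν + μ) ≤ δ * q ^ 2) (h6 : residualSq Z mδ ν ≤ δ * q ^ 2)
    (h7 : αY * Real.log (models p uθ).card ≤ δ * q ^ 2)
    (h8 : αX * Real.log (models p uδ).card ≤ δ * q ^ 2)
    (hηε : |inner ℝ η ε| ≤ δ * q ^ 3) (hη : |‖η‖ ^ 2 - c * q ^ 4| ≤ δ * q ^ 3) :
    |q ^ 2 * (betaEW αY αX uθ uδ Z (ν + η) (β • (ν + η) + μ + ε) - β) -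
        inner ℝ η ε / (c * q ^ 2)| ≤
      2 * (4 * (30 * (β ^ 2 + 1)) + c * (3 * (30 * (β ^ 2 + 1)) * (1 + |β|))) * δ / c ^ 2 := by
  have hY : β • (ν + η) + μ + ε = (β • ν + μ) + (β • η + ε) := by
    rw [smul_add]; abel
  rw [hY]
  have hδq : 0 ≤ δ * q ^ 2 := by positivity
  have hle : δ * q ^ 2 ≤ 2 * (β ^ 2 + 1) * (δ * q ^ 2) := by nlinarith [sq_nonneg β]
  have hξ : ∀ m ∈ models p uθ, ‖(augSpace Z m (β • ν + μ)).starProjection (β • η + ε)‖ ^ 2 ≤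
      2 * (β ^ 2 + 1) * (δ * q ^ 2) := by
    intro m hm
    have e1 := (sq_norm_le_supProj Z (β • ν + μ) η hm).trans h1
    have e2 := (sq_norm_le_supProj Z (β • ν + μ) ε hm).trans h2
    rw [map_add, map_smul]
    set x := (augSpace Z m (β • ν + μ)).starProjection η
    set y := (augSpace Z m (β • ν + μ)).starProjection ε
    have e3 : ‖β • x + y‖ ≤ |β| * ‖x‖ + ‖y‖ := by
      refine (norm_add_le _ _).trans ?_
      rw [norm_smul, Real.norm_eq_abs]
    have e4 : ‖β • x + y‖ ^ 2 ≤ (|β| * ‖x‖ + ‖y‖) ^ 2 := by gcongr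
    have e5 : (|β| * ‖x‖ + ‖y‖) ^ 2 ≤ 2 * (β ^ 2 * ‖x‖ ^ 2) + 2 * ‖y‖ ^ 2 := by
      rw [← sq_abs β]
      nlinarith [sq_nonneg (|β| * ‖x‖ - ‖y‖)]
    have e6 : β ^ 2 * ‖x‖ ^ 2 ≤ β ^ 2 * (δ * q ^ 2) := by gcongr
    linarith
  have hθ := ewResidual_sub_noise_bounds hαY hsθ huθ hξ hmθ (h5.trans hle) (h7.trans hle)
  have hδ := ewResidual_sub_noise_bounds (f := ν) (ξ := η) hαX hsδ huδ
    (fun m hm => ((sq_norm_le_supProj Z ν η hm).trans h3).trans hle) hmδ (h6.trans hle)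
    (h8.trans hle)
  have hA : 15 * (2 * (β ^ 2 + 1) * (δ * q ^ 2)) = 30 * (β ^ 2 + 1) * (δ * q ^ 2) := by ring
  rw [hA] at hθ hδ
  unfold betaEW
  refine abs_ratio_sub_le (dx := ewResidual αX uδ Z (ν + η) - η)
    (dy := ewResidual αY uθ Z (β • ν + μ + (β • η + ε)) - (β • η + ε))
    (by abel) (by abel) hq hc (by nlinarith [sq_nonneg β]) hδ0 hδ1 hδc hηε hη hδ.1 hθ.1
    (hδ.2 η fun m hm => ((sq_norm_le_supProj Z ν η hm).trans h3).trans hle)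
    (hθ.2 η fun m hm => ((sq_norm_le_supProj Z _ η hm).trans h1).trans hle)
    (hδ.2 ε fun m hm => ((sq_norm_le_supProj Z ν ε hm).trans h4).trans hle)

end Deviation

/-! ### Moments of squares and of products of independent errors -/

section Rows

variable {Ω : Type*} [MeasurableSpace Ω] {P : Measure Ω}

lemma integrable_abs_pow {X : Ω → ℝ} {c : ℝ≥0} (hX : HasSubgaussianMGF X c P) {k : ℕ}
    (hk : k ≠ 0) : Integrable (fun ω => |X ω| ^ k) P := by
  simpa using (hX.memLp k).integrable_norm_pow hk

lemma integral_sq_eq_variance {X : Ω → ℝ} {v : ℝ} (hX : AEMeasurable X P)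
    (h0 : ∫ ω, X ω ∂P = 0) (hv : Var[X; P] = v) : ∫ ω, X ω ^ 2 ∂P = v := by
  rw [← hv, variance_of_integral_eq_zero hX h0]

variable {X Y : Ω → ℝ} {cX cY : ℝ≥0}

lemma integral_mul_eq_zero (hXY : IndepFun X Y P) (hX : HasSubgaussianMGF X cX P)
    (hY : HasSubgaussianMGF Y cY P) (hX0 : ∫ ω, X ω ∂P = 0) : ∫ ω, X ω * Y ω ∂P = 0 := by
  rw [hXY.integral_fun_mul_eq_mul_integral hX.aestronglyMeasurable hY.aestronglyMeasurable, hX0,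
    zero_mul]

lemma integral_mul_sq_eq (hXY : IndepFun X Y P) (hX : HasSubgaussianMGF X cX P)
    (hY : HasSubgaussianMGF Y cY P) {vX vY : ℝ} (hX0 : ∫ ω, X ω ∂P = 0) (hY0 : ∫ ω, Y ω ∂P = 0)
    (hvX : Var[X; P] = vX) (hvY : Var[Y; P] = vY) :
    ∫ ω, (X ω * Y ω) ^ 2 ∂P = vX * vY := by
  have h2 : IndepFun (fun ω => X ω ^ 2) (fun ω => Y ω ^ 2) P :=
    hXY.comp (measurable_id.pow_const 2) (measurable_id.pow_const 2)
  simp_rw [mul_pow]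
  rw [h2.integral_fun_mul_eq_mul_integral (hX.aestronglyMeasurable.pow 2)
    (hY.aestronglyMeasurable.pow 2), integral_sq_eq_variance hX.aemeasurable hX0 hvX,
    integral_sq_eq_variance hY.aemeasurable hY0 hvY]

lemma memLp_two_mul (hXY : IndepFun X Y P) (hX : HasSubgaussianMGF X cX P)
    (hY : HasSubgaussianMGF Y cY P) : MemLp (fun ω => X ω * Y ω) 2 P := by
  have h2 : IndepFun (fun ω => X ω ^ 2) (fun ω => Y ω ^ 2) P :=
    hXY.comp (measurable_id.pow_const 2) (measurable_id.pow_const 2)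
  refine (memLp_two_iff_integrable_sq
    (hX.aestronglyMeasurable.mul hY.aestronglyMeasurable)).2 ?_
  refine (h2.integrable_mul (hX.memLp 2).integrable_sq (hY.memLp 2).integrable_sq).congr
    (ae_of_all _ fun ω => ?_)
  simp [mul_pow]

lemma memLp_two_sq {X : Ω → ℝ} {c : ℝ≥0} (hX : HasSubgaussianMGF X c P) :
    MemLp (fun ω => X ω ^ 2) 2 P := by
  refine (memLp_two_iff_integrable_sq (hX.aestronglyMeasurable.pow 2)).2 ?_
  refine (integrable_abs_pow hX (k := 4) (by norm_num)).congr (ae_of_all _ fun ω => ?_)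
  change |X ω| ^ 4 = (X ω ^ 2) ^ 2
  rw [Even.pow_abs ⟨2, rfl⟩]
  ring

lemma pow_le_one_add_pow_six (x : ℝ) {k : ℕ} (hk : k ≤ 6) : |x| ^ k ≤ 1 + x ^ 6 := by
  have h6 : |x| ^ 6 = x ^ 6 := Even.pow_abs ⟨3, rfl⟩ x
  rw [← h6]
  rcases le_total |x| 1 with h | h
  · exact (pow_le_one₀ (abs_nonneg x) h).trans (by linarith [pow_nonneg (abs_nonneg x) 6])
  · exact (pow_le_pow_right₀ h hk).trans (by linarith)

variable [IsProbabilityMeasure P]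

lemma integral_abs_pow_le {X : Ω → ℝ} {c : ℝ≥0} (hX : HasSubgaussianMGF X c P) {k : ℕ}
    (hk0 : k ≠ 0) (hk : k ≤ 6) :
    ∫ ω, |X ω| ^ k ∂P ≤ 1 + 1440 * Real.exp (c / 2) := by
  calc ∫ ω, |X ω| ^ k ∂P ≤ ∫ ω, (1 + X ω ^ 6) ∂P :=
        integral_mono (integrable_abs_pow hX hk0)
          ((integrable_const _).add (integrable_pow_six hX))
          fun ω => pow_le_one_add_pow_six (X ω) hk
    _ ≤ _ := by
        rw [integral_add (integrable_const _) (integrable_pow_six hX)]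
        simpa using integral_pow_six_le hX

lemma variance_sq_le {X : Ω → ℝ} {c : ℝ≥0} (hX : HasSubgaussianMGF X c P) :
    Var[fun ω => X ω ^ 2; P] ≤ 1 + 1440 * Real.exp (c / 2) := by
  refine (variance_le_expectation_sq (hX.aestronglyMeasurable.pow 2)).trans ?_
  refine le_trans (le_of_eq ?_) (integral_abs_pow_le hX (k := 4) (by norm_num) (by norm_num))
  refine integral_congr_ae (ae_of_all _ fun ω => ?_)
  change (X ω ^ 2) ^ 2 = |X ω| ^ 4
  rw [Even.pow_abs ⟨2, rfl⟩]
  ring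

lemma integrable_abs_mul_pow_three (hXY : IndepFun X Y P) (hX : HasSubgaussianMGF X cX P)
    (hY : HasSubgaussianMGF Y cY P) : Integrable (fun ω => |X ω * Y ω| ^ 3) P ∧
    ∫ ω, |X ω * Y ω| ^ 3 ∂P ≤
      (1 + 1440 * Real.exp (cX / 2)) * (1 + 1440 * Real.exp (cY / 2)) := by
  have h3 : IndepFun (fun ω => |X ω| ^ 3) (fun ω => |Y ω| ^ 3) P :=
    hXY.comp (measurable_id.abs.pow_const 3) (measurable_id.abs.pow_const 3)
  have iX := integrable_abs_pow hX (k := 3) (by norm_num)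
  have iY := integrable_abs_pow hY (k := 3) (by norm_num)
  simp_rw [abs_mul, mul_pow]
  refine ⟨h3.integrable_mul iX iY, ?_⟩
  rw [h3.integral_fun_mul_eq_mul_integral iX.aestronglyMeasurable iY.aestronglyMeasurable]
  exact mul_le_mul (integral_abs_pow_le hX (by norm_num) (by norm_num))
    (integral_abs_pow_le hY (by norm_num) (by norm_num))
    (integral_nonneg fun _ => by positivity) (by positivity)

end Rows

/-! ### Consequences of the growth condition on the model sizes -/

section ModelSize

lemma tendsto_size_mul_log {p u v : ℕ → ℕ} (huv : ∀ n, u n ≤ v n)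
    (hv : (fun n => (v n : ℝ)) =o[atTop] fun n => √(n : ℝ) / Real.log (p n)) :
    Tendsto (fun n => u n * Real.log (p n) / √(n : ℝ)) atTop (𝓝 0) := by
  have h := hv.tendsto_div_nhds_zero
  simp_rw [div_div_eq_mul_div] at h
  refine tendsto_of_tendsto_of_tendsto_of_le_of_le tendsto_const_nhds h (fun n => ?_) fun n => ?_
  · have := Real.log_natCast_nonneg (p n)
    positivity
  · have := Real.log_natCast_nonneg (p n)
    have : (u n : ℝ) ≤ v n := by exact_mod_cast huv n
    simp only
    gcongr

/-- Guarantees that the family of models is nonempty, so that the weights sum to one. Eventually `u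
log p ≤ √n log 2` and `p ≥ 2`, hence `u ≤ √n ≤ n < p`. -/
lemma eventually_size_le {p u : ℕ → ℕ} (hp : ∀ᶠ n in atTop, n < p n)
    (hu : Tendsto (fun n => u n * Real.log (p n) / √(n : ℝ)) atTop (𝓝 0)) :
    ∀ᶠ n in atTop, u n ≤ p n := by
  have hlog2 : 0 < Real.log 2 := Real.log_pos (by norm_num)
  filter_upwards [hp, hu.eventually_le_const hlog2, eventually_ge_atTop 1] with n hn h h1
  have hn1 : (1 : ℝ) ≤ n := by exact_mod_cast h1
  have hs : 0 < √(n : ℝ) := Real.sqrt_pos.2 (by linarith)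
  have h2 : Real.log 2 ≤ Real.log (p n) :=
    Real.log_le_log (by norm_num) (by exact_mod_cast (by omega : 2 ≤ p n))
  rw [div_le_iff₀ hs] at h
  have h3 : u n * Real.log 2 ≤ Real.log 2 * √(n : ℝ) :=
    (mul_le_mul_of_nonneg_left h2 (Nat.cast_nonneg _)).trans h
  have h4 : (u n : ℝ) ≤ √(n : ℝ) := by
    rw [mul_comm] at h3
    exact le_of_mul_le_mul_left h3 hlog2
  have h5 : √(n : ℝ) ≤ n := by
    rw [Real.sqrt_le_left (by linarith)]
    nlinarith
  have h6 : u n ≤ n := by exact_mod_cast h4.trans h5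
  omega

lemma eventually_log_card_models_le {p u : ℕ → ℕ} {α δ : ℝ} (hα : 0 < α) (hδ : 0 < δ)
    (hup : ∀ᶠ n in atTop, u n ≤ p n)
    (hu : Tendsto (fun n => u n * Real.log (p n) / √(n : ℝ)) atTop (𝓝 0)) :
    ∀ᶠ n : ℕ in atTop, α * Real.log (models (p n) (u n)).card ≤ δ * √(n : ℝ) := by
  have h := hu.const_mul α
  rw [mul_zero] at h
  filter_upwards [h.eventually_le_const hδ, eventually_ge_atTop 1, hup] with n hn h1 hle
  have hs : 0 < √(n : ℝ) := Real.sqrt_pos.2 (by exact_mod_cast h1)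
  rw [← mul_div_assoc, div_le_iff₀ hs] at hn
  refine (mul_le_mul_of_nonneg_left ?_ hα.le).trans hn
  rw [← Real.log_pow]
  refine Real.log_le_log ?_ (by exact_mod_cast card_models_le _ _)
  exact_mod_cast (models_nonempty hle).card_pos

end ModelSize

/-! ### Linearization of the scaled error -/

section Remainder

variable {Ω : ℕ → Type*} [∀ n, MeasurableSpace (Ω n)] {P : ∀ n, Measure (Ω n)}

/-- The scaled estimation error is `⟪η, ε⟫ / (c √n)` up to a remainder that is `o_p(1)`. -/
lemma isLittleOInProb_scaled_error_sub {p uθ uδ sθ sδ : ℕ → ℕ} {β αY αX c : ℝ}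
    (hαY : 0 < αY) (hαX : 0 < αX) (hc : 0 < c)
    (huθp : ∀ᶠ n in atTop, uθ n ≤ p n) (huδp : ∀ᶠ n in atTop, uδ n ≤ p n)
    (hsθ : ∀ᶠ n in atTop, sθ n ≤ uθ n) (hsδ : ∀ᶠ n in atTop, sδ n ≤ uδ n)
    (huθ : Tendsto (fun n => uθ n * Real.log (p n) / √(n : ℝ)) atTop (𝓝 0))
    (huδ : Tendsto (fun n => uδ n * Real.log (p n) / √(n : ℝ)) atTop (𝓝 0))
    {Z : ∀ n, Ω n → Matrix (Fin n) (Fin (p n)) ℝ}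
    {μ ν η ε : ∀ n, Ω n → EuclideanSpace ℝ (Fin n)}
    (hθη : IsLittleOInProb P (fun n ω => supProj (uθ n) (Z n ω) (β • ν n ω + μ n ω) (η n ω))
      (fun n => √(n : ℝ)))
    (hθε : IsLittleOInProb P (fun n ω => supProj (uθ n) (Z n ω) (β • ν n ω + μ n ω) (ε n ω))
      (fun n => √(n : ℝ)))
    (hδη : IsLittleOInProb P (fun n ω => supProj (uδ n) (Z n ω) (ν n ω) (η n ω))
      (fun n => √(n : ℝ)))
    (hδε : IsLittleOInProb P (fun n ω => supProj (uδ n) (Z n ω) (ν n ω) (ε n ω))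
      (fun n => √(n : ℝ)))
    {mθ mδ : ∀ n, Finset (Fin (p n))} (hmθ : ∀ n, mθ n ∈ models (p n) (sθ n))
    (hmδ : ∀ n, mδ n ∈ models (p n) (sδ n))
    (hresθ : IsLittleOInProb P (fun n ω => residualSq (Z n ω) (mθ n) (β • ν n ω + μ n ω))
      (fun n => √(n : ℝ)))
    (hresδ : IsLittleOInProb P (fun n ω => residualSq (Z n ω) (mδ n) (ν n ω))
      (fun n => √(n : ℝ)))
    (hηε : IsLittleOInProb P (fun n ω => inner ℝ (η n ω) (ε n ω))
      (fun n => √(n : ℝ) * √√(n : ℝ)))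
    (hη : IsLittleOInProb P (fun n ω => ‖η n ω‖ ^ 2 - n * c)
      (fun n => √(n : ℝ) * √√(n : ℝ))) :
    IsLittleOInProb P (fun n ω => √(n : ℝ) * (betaEW αY αX (uθ n) (uδ n) (Z n ω) (ν n ω + η n ω)
      (β • (ν n ω + η n ω) + μ n ω + ε n ω) - β) - inner ℝ (η n ω) (ε n ω) / (c * √(n : ℝ))) 1 := by
  let V : Fin 8 → ∀ n, Ω n → ℝ :=
    ![fun n ω => supProj (uθ n) (Z n ω) (β • ν n ω + μ n ω) (η n ω),
      fun n ω => supProj (uθ n) (Z n ω) (β • ν n ω + μ n ω) (ε n ω),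
      fun n ω => supProj (uδ n) (Z n ω) (ν n ω) (η n ω),
      fun n ω => supProj (uδ n) (Z n ω) (ν n ω) (ε n ω),
      fun n ω => residualSq (Z n ω) (mθ n) (β • ν n ω + μ n ω),
      fun n ω => residualSq (Z n ω) (mδ n) (ν n ω),
      fun n ω => inner ℝ (η n ω) (ε n ω),
      fun n ω => ‖η n ω‖ ^ 2 - n * c]
  let r : Fin 8 → ℕ → ℝ :=
    ![fun n => √(n : ℝ), fun n => √(n : ℝ), fun n => √(n : ℝ), fun n => √(n : ℝ),
      fun n => √(n : ℝ), fun n => √(n : ℝ), fun n => √(n : ℝ) * √√(n : ℝ),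
      fun n => √(n : ℝ) * √√(n : ℝ)]
  have hV : ∀ i, IsLittleOInProb P (V i) (r i) := by
    intro i
    fin_cases i
    exacts [hθη, hθε, hδη, hδε, hresθ, hresδ, hηε, hη]
  refine IsLittleOInProb.of_forall_imp hV fun κ hκ => ?_
  obtain ⟨A, hA⟩ : ∃ A, A = 30 * (β ^ 2 + 1) := ⟨_, rfl⟩
  have hA0 : 0 < A := by rw [hA]; positivity
  obtain ⟨G, hG⟩ : ∃ G, G = 2 * (4 * A + c * (3 * A * (1 + |β|))) := ⟨_, rfl⟩
  have hG0 : 0 < G := by rw [hG]; positivity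
  -- The three entries give `δ² ≤ δ`, keep `‖rX‖²` above half of `c n`, and make the final bound `G
  -- δ / c²` at most `κ`.
  obtain ⟨δ, hδ⟩ : ∃ δ, δ = min 1 (min (c / (8 * A)) (κ * c ^ 2 / G)) := ⟨_, rfl⟩
  have hδ0 : 0 < δ := by rw [hδ]; positivity
  have hδ1 : δ ≤ 1 := hδ ▸ min_le_left _ _
  have hδc : 8 * A * δ ≤ c := by
    have : δ ≤ c / (8 * A) := hδ ▸ (min_le_right _ _).trans (min_le_left _ _)
    rw [le_div_iff₀ (by positivity)] at this
    linarith
  have hδκ : G * δ / c ^ 2 ≤ κ := by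
    have : δ ≤ κ * c ^ 2 / G := hδ ▸ (min_le_right _ _).trans (min_le_right _ _)
    rw [le_div_iff₀ hG0] at this
    rw [div_le_iff₀ (by positivity)]
    linarith
  refine ⟨δ, hδ0, ?_⟩
  filter_upwards [eventually_ge_atTop 1, huθp, huδp, hsθ, hsδ,
    eventually_log_card_models_le hαY hδ0 huθp huθ,
    eventually_log_card_models_le hαX hδ0 huδp huδ] with n hn1 hθp hδp hsθn hsδn hlogθ hlogδ ω hω
  have hn1' : (1 : ℝ) ≤ n := by exact_mod_cast hn1
  obtain ⟨q, hq⟩ : ∃ q, q = √√(n : ℝ) := ⟨_, rfl⟩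
  have hq1 : 1 ≤ q := by
    rw [hq]
    exact Real.one_le_sqrt.2 (Real.one_le_sqrt.2 hn1')
  have hq2 : q ^ 2 = √(n : ℝ) := by rw [hq]; exact Real.sq_sqrt (Real.sqrt_nonneg _)
  have hq3 : q ^ 3 = √(n : ℝ) * √√(n : ℝ) := by rw [pow_succ, hq2, hq]
  have hq4 : c * q ^ 4 = n * c := by
    have : q ^ 4 = (q ^ 2) ^ 2 := by ring
    rw [this, hq2, Real.sq_sqrt (by linarith), mul_comm]
  have h0 : |supProj (uθ n) (Z n ω) (β • ν n ω + μ n ω) (η n ω)| ≤ δ * √(n : ℝ) := hω 0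
  have h1 : |supProj (uθ n) (Z n ω) (β • ν n ω + μ n ω) (ε n ω)| ≤ δ * √(n : ℝ) := hω 1
  have h2 : |supProj (uδ n) (Z n ω) (ν n ω) (η n ω)| ≤ δ * √(n : ℝ) := hω 2
  have h3 : |supProj (uδ n) (Z n ω) (ν n ω) (ε n ω)| ≤ δ * √(n : ℝ) := hω 3
  have h4 : |residualSq (Z n ω) (mθ n) (β • ν n ω + μ n ω)| ≤ δ * √(n : ℝ) := hω 4
  have h5 : |residualSq (Z n ω) (mδ n) (ν n ω)| ≤ δ * √(n : ℝ) := hω 5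
  have h6 : |inner ℝ (η n ω) (ε n ω)| ≤ δ * (√(n : ℝ) * √√(n : ℝ)) := hω 6
  have h7 : |‖η n ω‖ ^ 2 - n * c| ≤ δ * (√(n : ℝ) * √√(n : ℝ)) := hω 7
  rw [← hq2] at h0 h1 h2 h3 h4 h5 hlogθ hlogδ
  rw [← hq3] at h6 h7
  rw [← hq4] at h7
  have key := scaled_error_le (Z := Z n ω) (μ := μ n ω) (ν := ν n ω) (η := η n ω)
    (ε := ε n ω) (β := β) (c := c) (q := q) (δ := δ) hαY hαX hq1 hc hδ0.le hδ1 (hA ▸ hδc)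
    hsθn hθp hsδn hδp ((le_abs_self _).trans h0) ((le_abs_self _).trans h1)
    ((le_abs_self _).trans h2) ((le_abs_self _).trans h3) (hmθ n) (hmδ n)
    ((le_abs_self _).trans h4) ((le_abs_self _).trans h5) hlogθ hlogδ h6 h7
  rw [← hA, ← hG, hq2] at key
  simpa using key.trans hδκ

end Remainder

end ExpWeights

end

/-! ### The main theorem -/

open ExpWeights in
theorem mainTheorem1
    {Ω : ℕ → Type*} [∀ n, MeasurableSpace (Ω n)]
    (P : ∀ n, Measure (Ω n)) [∀ n, IsProbabilityMeasure (P n)]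
    -- dimensions, parameters, tuning parameters
    (p : ℕ → ℕ) (hp : ∀ᶠ n in atTop, n < p n)
    (β : ℝ) (σε ση Kε Kη : ℝ≥0) (hση : 0 < ση)
    (αY αX : ℝ) (hαY : 4 * (Kε : ℝ) ^ 2 < αY) (hαX : 4 * (Kη : ℝ) ^ 2 < αX)
    (sγ sδ sθ uγ uδ uθ : ℕ → ℕ)
    -- the data, the means and the errors
    (Z : ∀ n, Ω n → Matrix (Fin n) (Fin (p n)) ℝ)
    (X Y μ ν η ε : ∀ n, Ω n → EuclideanSpace ℝ (Fin n))
    (hZm : ∀ n i j, Measurable (fun ω => Z n ω i j))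
    (hμm : ∀ n, Measurable (μ n)) (hνm : ∀ n, Measurable (ν n))
    (hηm : ∀ n, Measurable (η n)) (hεm : ∀ n, Measurable (ε n))
    -- the two partially linear models
    (hY : ∀ n ω, Y n ω = β • X n ω + μ n ω + ε n ω)
    (hX : ∀ n ω, X n ω = ν n ω + η n ω)
    -- bounded norms
    (hμ : ExpWeights.IsBigOInProb P (fun n ω => ‖μ n ω‖ ^ 2) (fun n => (n : ℝ)))
    (hν : ExpWeights.IsBigOInProb P (fun n ω => ‖ν n ω‖ ^ 2) (fun n => (n : ℝ)))
    -- the errors: mutually independent, independent of the design and the means,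
    -- identically distributed and sub-Gaussian
    (hindep : ∀ n, iIndepFun (fun (k : Fin n ⊕ Fin n) (ω : Ω n) =>
      Sum.elim (fun i => η n ω i) (fun i => ε n ω i) k) (P n))
    (hindepZ : ∀ n, IndepFun (fun ω => ((fun i j => Z n ω i j : Fin n → Fin (p n) → ℝ),
      μ n ω, ν n ω)) (fun ω => (η n ω, ε n ω)) (P n))
    (hηid : ∀ n i j, IdentDistrib (fun ω => η n ω i) (fun ω => η n ω j) (P n) (P n))
    (hεid : ∀ n i j, IdentDistrib (fun ω => ε n ω i) (fun ω => ε n ω j) (P n) (P n))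
    (hηsg : ∀ n i, ∫ ω, η n ω i ∂(P n) = 0 ∧
      HasSubgaussianMGF (fun ω => η n ω i) (Kη ^ 2) (P n))
    (hεsg : ∀ n i, ∫ ω, ε n ω i ∂(P n) = 0 ∧
      HasSubgaussianMGF (fun ω => ε n ω i) (Kε ^ 2) (P n))
    (hηvar : ∀ n i, Var[fun ω => η n ω i; P n] = (ση : ℝ) ^ 2)
    (hεvar : ∀ n i, Var[fun ω => ε n ω i; P n] = (σε : ℝ) ^ 2)
    -- weak sparsity at rate `√n` and the chosen model sizes
    (hμs : ExpWeights.WeaklySparse P Z μ sγ (fun n => √(n : ℝ)))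
    (hνs : ExpWeights.WeaklySparse P Z ν sδ (fun n => √(n : ℝ)))
    (hθs : ExpWeights.WeaklySparse P Z (fun n ω => β • ν n ω + μ n ω) sθ (fun n => √(n : ℝ)))
    (hu : ∀ᶠ n in atTop, sγ n ≤ uγ n ∧ sδ n ≤ uδ n ∧ sθ n ≤ uθ n)
    (huo : (fun n => ((max (max (uγ n) (uδ n)) (uθ n) : ℕ) : ℝ)) =o[atTop]
      (fun n => √(n : ℝ) / Real.log (p n))) :
    TendstoInDistribution
      (fun (n : ℕ) ω => √(n : ℝ) *
        (ExpWeights.betaEW αY αX (uθ n) (uδ n) (Z n ω) (X n ω) (Y n ω) - β))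
      atTop (id : ℝ → ℝ) P (gaussianReal 0 (σε ^ 2 / ση ^ 2)) ∧
    -- under Gaussian noise the limiting variance is the semiparametric information bound
    (0 < σε → (∀ n i, (P n).map (fun ω => ε n ω i) = gaussianReal 0 (σε ^ 2)) →
      ∀ n, 1 ≤ n → ExpWeights.informationBound (P n) σε β
        (fun ω => ((fun i j => Z n ω i j : Fin n → Fin (p n) → ℝ), μ n ω, ν n ω))
        (X n) (μ n) (Y n) = ((σε ^ 2 / ση ^ 2 : ℝ≥0) : ℝ≥0∞)) := by

  have hαY0 : 0 < αY := lt_of_le_of_lt (by positivity) hαY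
  have hαX0 : 0 < αX := lt_of_le_of_lt (by positivity) hαX
  have hση' : 0 < (ση : ℝ) := by exact_mod_cast hση
  have hc : 0 < (ση : ℝ) ^ 2 := by positivity
  have hηi : ∀ n i, Measurable fun ω => η n ω i := fun n i => by
    have := hηm n
    fun_prop
  have hεi : ∀ n i, Measurable fun ω => ε n ω i := fun n i => by
    have := hεm n
    fun_prop
  have hindη : ∀ n, iIndepFun (fun i ω => η n ω i) (P n) := fun n =>
    (hindep n).precomp (g := Sum.inl) Sum.inl_injective
  have hindε : ∀ n, iIndepFun (fun i ω => ε n ω i) (P n) := fun n =>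
    (hindep n).precomp (g := Sum.inr) Sum.inr_injective
  have hηεvec : ∀ n, IndepFun (fun ω i => η n ω i) (fun ω i => ε n ω i) (P n) := fun n =>
    indepFun_of_iIndepFun_sum (hηi n) (hεi n) (hindep n)
  have hηε : ∀ n, IndepFun (η n) (ε n) (P n) := fun n =>
    (hηεvec n).comp (WithLp.measurable_toLp 2 _) (WithLp.measurable_toLp 2 _)
  have hηεi : ∀ n i, IndepFun (fun ω => η n ω i) (fun ω => ε n ω i) (P n) := fun n i =>
    (hηεvec n).comp (measurable_pi_apply i) (measurable_pi_apply i)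
  -- All spaces `span (Z_m, f)`, for `f = ν` and `f = βν + μ`, are functions of `W`, which is
  -- independent of the errors.
  let W : ∀ n, Ω n → (Fin n → Fin (p n) → ℝ) × EuclideanSpace ℝ (Fin n) ×
    EuclideanSpace ℝ (Fin n) := fun n ω => (fun i j => Z n ω i j, μ n ω, ν n ω)
  have hW : ∀ n, Measurable (W n) := fun n =>
    (measurable_pi_lambda _ fun i => measurable_pi_lambda _ fun j => hZm n i j).prodMk
      ((hμm n).prodMk (hνm n))
  have hindW : ∀ n, IndepFun (W n) (fun ω => (η n ω, ε n ω)) (P n) := hindepZ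
  have hWη : ∀ n, IndepFun (W n) (η n) (P n) := fun n =>
    (hindW n).comp measurable_id measurable_fst
  have hWε : ∀ n, IndepFun (W n) (ε n) (P n) := fun n =>
    (hindW n).comp measurable_id measurable_snd
  refine ⟨?_, fun hσε _ n hn => ?_⟩
  swap
  · exact informationBound_eq hσε hση hn (hW n) (hηm n) (hεm n) (hY n) (hX n) (hηε n) (hindW n)
      (hindε n) (fun i => (hηsg n i).2.memLp 2) (fun i => (hεsg n i).2.memLp 2)
      (fun i => (hηsg n i).1) (fun i => (hεsg n i).1) (hηvar n) (hεvar n)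
      (ν' := fun w => w.2.2) (measurable_snd.comp measurable_snd) fun _ => rfl
  have huθ := tendsto_size_mul_log (u := uθ) (fun n => le_max_right _ _) huo
  have huδ := tendsto_size_mul_log (u := uδ)
    (fun n => (le_max_right _ _).trans (le_max_left _ _)) huo
  have huθp := eventually_size_le hp huθ
  have huδp := eventually_size_le hp huδ
  have hXm : ∀ n, Measurable (X n) := fun n => by
    have : X n = fun ω => ν n ω + η n ω := funext (hX n)
    rw [this]
    exact (hνm n).add (hηm n)
  have hYm : ∀ n, Measurable (Y n) := fun n => by
    have : Y n = fun ω => β • X n ω + μ n ω + ε n ω := funext (hY n)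
    rw [this]
    exact (((hXm n).const_smul β).add (hμm n)).add (hεm n)
  obtain ⟨mδ, hmδ, hresδ⟩ := hνs
  obtain ⟨mθ, hmθ, hresθ⟩ := hθs
  -- the maximal projections of the two noise vectors
  have hZw : ∀ n i j, Measurable fun w : (Fin n → Fin (p n) → ℝ) × EuclideanSpace ℝ (Fin n) ×
      EuclideanSpace ℝ (Fin n) => (Matrix.of w.1 : Matrix (Fin n) (Fin (p n)) ℝ) i j :=
    fun n i j => (measurable_pi_apply j).comp ((measurable_pi_apply i).comp measurable_fst)
  have hfθ : ∀ n, Measurable fun w : (Fin n → Fin (p n) → ℝ) × EuclideanSpace ℝ (Fin n) ×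
      EuclideanSpace ℝ (Fin n) => β • w.2.2 + w.2.1 := fun n => by fun_prop
  have hfδ : ∀ n, Measurable fun w : (Fin n → Fin (p n) → ℝ) × EuclideanSpace ℝ (Fin n) ×
      EuclideanSpace ℝ (Fin n) => w.2.2 := fun n => by fun_prop
  have hθη : IsLittleOInProb P (fun n ω => supProj (uθ n) (Z n ω) (β • ν n ω + μ n ω) (η n ω))
      (fun n => √(n : ℝ)) :=
    isLittleOInProb_supProj hp huθ hW hηm hWη hindη (fun n i => (hηsg n i).2)
      (fun _ w => Matrix.of w.1) (fun _ w => β • w.2.2 + w.2.1) (fun _ _ => rfl) (fun _ _ => rfl) hZw hfθ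
  have hθε : IsLittleOInProb P (fun n ω => supProj (uθ n) (Z n ω) (β • ν n ω + μ n ω) (ε n ω))
      (fun n => √(n : ℝ)) :=
    isLittleOInProb_supProj hp huθ hW hεm hWε hindε (fun n i => (hεsg n i).2)
      (fun _ w => Matrix.of w.1) (fun _ w => β • w.2.2 + w.2.1) (fun _ _ => rfl) (fun _ _ => rfl) hZw hfθ
  have hδη : IsLittleOInProb P (fun n ω => supProj (uδ n) (Z n ω) (ν n ω) (η n ω))
      (fun n => √(n : ℝ)) :=
    isLittleOInProb_supProj hp huδ hW hηm hWη hindη (fun n i => (hηsg n i).2)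
      (fun _ w => Matrix.of w.1) (fun _ w => w.2.2) (fun _ _ => rfl) (fun _ _ => rfl) hZw hfδ
  have hδε : IsLittleOInProb P (fun n ω => supProj (uδ n) (Z n ω) (ν n ω) (ε n ω))
      (fun n => √(n : ℝ)) :=
    isLittleOInProb_supProj hp huδ hW hεm hWε hindε (fun n i => (hεsg n i).2)
      (fun _ w => Matrix.of w.1) (fun _ w => w.2.2) (fun _ _ => rfl) (fun _ _ => rfl) hZw hfδ
  -- the laws of large numbers for `⟪η, ε⟫` and `‖η‖ ^ 2`
  have hmulind : ∀ n, iIndepFun (fun i ω => η n ω i * ε n ω i) (P n) := fun n =>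
    iIndepFun_mul_of_iIndepFun_sum (hηi n) (hεi n) (hindep n)
  have hmul0 : ∀ n i, ∫ ω, η n ω i * ε n ω i ∂(P n) = 0 := fun n i =>
    integral_mul_eq_zero (hηεi n i) (hηsg n i).2 (hεsg n i).2 (hηsg n i).1
  have hmulsq : ∀ n i, ∫ ω, (η n ω i * ε n ω i) ^ 2 ∂(P n) = (ση : ℝ) ^ 2 * (σε : ℝ) ^ 2 :=
    fun n i => integral_mul_sq_eq (hηεi n i) (hηsg n i).2 (hεsg n i).2 (hηsg n i).1 (hεsg n i).1
      (hηvar n i) (hεvar n i)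
  have hmulL2 : ∀ n i, MemLp (fun ω => η n ω i * ε n ω i) 2 (P n) := fun n i =>
    memLp_two_mul (hηεi n i) (hηsg n i).2 (hεsg n i).2
  have hllnηε : IsLittleOInProb P (fun n ω => inner ℝ (η n ω) (ε n ω))
      (fun n => √(n : ℝ) * √√(n : ℝ)) := by
    have h := isLittleOInProb_sum_sub (X := fun n i ω => η n ω i * ε n ω i) hmulL2 hmulind hmul0
      (M := (ση : ℝ) ^ 2 * (σε : ℝ) ^ 2) fun n i => ((variance_of_integral_eq_zero
        ((hηi n i).mul (hεi n i)).aemeasurable (hmul0 n i)).trans (hmulsq n i)).le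
    convert h using 3 with n ω
    simp [PiLp.inner_apply, mul_comm]
  have hllnη : IsLittleOInProb P (fun n ω => ‖η n ω‖ ^ 2 - n * (ση : ℝ) ^ 2)
      (fun n => √(n : ℝ) * √√(n : ℝ)) := by
    have h := isLittleOInProb_sum_sub (X := fun n i ω => η n ω i ^ 2)
      (fun n i => memLp_two_sq (hηsg n i).2)
      (fun n => (hindη n).comp (fun _ x => x ^ 2) fun _ => measurable_id.pow_const 2)
      (fun n i => integral_sq_eq_variance (hηi n i).aemeasurable (hηsg n i).1 (hηvar n i))
      fun n i => variance_sq_le (hηsg n i).2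
    convert h using 3 with n ω
    rw [EuclideanSpace.norm_sq_eq]
    simp
  -- the leading term
  let S : ∀ n, Ω n → ℝ := fun n ω => (√(n : ℝ))⁻¹ * ∑ i, η n ω i * ε n ω i / (ση : ℝ) ^ 2
  have hS : ∀ n, Measurable (S n) := fun n =>
    (Finset.measurable_sum _ fun i _ => ((hηi n i).mul (hεi n i)).div_const _).const_mul _
  refine tendstoInDistribution_of_charFun_of_sub hS
    (fun n => ((measurable_betaEW (hZm n) αY αX (uθ n) (uδ n) (hXm n) (hYm n)).sub_const β).const_mul
      _) ?_ fun t => ?_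
  · have hrem := isLittleOInProb_scaled_error_sub hαY0 hαX0 hc huθp huδp
      (hu.mono fun _ h => h.2.2) (hu.mono fun _ h => h.2.1) huθ huδ hθη hθε hδη hδε hmθ hmδ
      hresθ hresδ hllnηε hllnη
    convert hrem using 3 with n ω
    rw [hY, hX]
    congr 1
    simp only [S]
    rw [← Finset.sum_div]
    have : inner ℝ (η n ω) (ε n ω) = ∑ i, η n ω i * ε n ω i := by
      simp [PiLp.inner_apply, mul_comm]
    rw [this, div_mul_eq_div_div, inv_mul_eq_div]
  · have hlim := tendsto_charFun_row_sum (P := P)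
      (X := fun n i ω => η n ω i * ε n ω i / (ση : ℝ) ^ 2)
      (v := (σε : ℝ) ^ 2 / (ση : ℝ) ^ 2)
      (M := (1 + 1440 * Real.exp (((Kη ^ 2 : ℝ≥0) : ℝ) / 2)) *
        (1 + 1440 * Real.exp (((Kε ^ 2 : ℝ≥0) : ℝ) / 2)) / |(ση : ℝ) ^ 2| ^ 3)
      (fun n i => ((hηi n i).mul (hεi n i)).div_const _)
      (fun n => (hmulind n).comp (fun _ x => x / (ση : ℝ) ^ 2) fun _ => by fun_prop)
      -- Equal marginals alone would not do: independence within each pair makes the pairs, hence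
      -- their products, identically distributed.
      (fun n i j => ((hηid n i j).prodMk (hεid n i j) (hηεi n i) (hηεi n j)).comp
        (u := fun x : ℝ × ℝ => x.1 * x.2 / (ση : ℝ) ^ 2) (by fun_prop))
      (fun n i => ?_) (fun n i => ?_) (fun n i => ?_) (fun n i => ?_) (fun n i => ?_) t
    · convert hlim using 2
      rw [charFun_gaussianReal]
      congr 1
      push_cast
      ring
    · simp_rw [abs_div, div_pow]
      exact (integrable_abs_mul_pow_three (hηεi n i) (hηsg n i).2 (hεsg n i).2).1.div_const _
    · simp_rw [div_eq_mul_inv]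
      exact (hmulL2 n i).mul_const _
    · rw [integral_div, hmul0, zero_div]
    · simp_rw [div_pow]
      rw [integral_div, hmulsq]
      field_simp
    · simp_rw [abs_div, div_pow]
      rw [integral_div]
      have := (integrable_abs_mul_pow_three (hηεi n i) (hηsg n i).2 (hεsg n i).2).2
      gcongr
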